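/- For an integer $a$ and $n\ge 0$ let $\left[{a\atop n}\right]_q=\frac{(q;q)_a}{(q;q)_n(q;q)_{a-n}}$ if $0\le n\le a$ and $0$ otherwise, where $(x;q)_n=\prod_{j=0}^{n-1}(1-xq^j)$. For $N\in\mathbb Z$ define the polynomials $$\mathrm{KR}_1(q,N)=\sum_{m,n\ge0}q^{m^2+3mn+3n^2}\left[{N-m-3n+1\atop m}\right]_q\left[{\lfloor\frac{2N}3\rfloor-m-n+1\atop n}\right]_{q^3},$$ $$\mathrm{KR}_2(q,N)=\sum_{m,n\ge0}q^{m^2+3mn+3n^2+m+3n}\left[{N-m-3n\atop m}\right]_q\left[{\lfloor\frac{2N}3\rfloor-m-n\atop n}\right]_{q^3},$$ $$\mathrm{KR}_3(q,N)=\sum_{m,n\ge0}q^{m^2+3mn+3n^2+2m+3n}\left[{N-m-3n-1\atop m}\right]^*_q\left[{\lfloor\frac{2N}3\rfloor-m-n\atop n}\right]_{q^3},$$ $$\mathrm{KR}_4(q,N)=\sum_{m,n\ge0}q^{m^2+3mn+3n^2+m+2n}\left[{N-m-3n\atop m}\right]_q\left[{\lfloor\frac{2(N-1)}3\rfloor-m-n+1\atop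 n}\right]_{q^3},$$ $$\mathrm{KR}_5(q,N)=\sum_{m,n\ge0}q^{m^2+3mn+3n^2+2m+4n}(1+q)\left[{N-m-3n-1\atop m}\right]_q\left[{\lfloor\frac{2(N-1)}3\rfloor-m-n+\delta_{3\mid(N-2)}\atop n}\right]_{q^3}$$ $$\qquad+\sum_{m,n\ge0}q^{m^2+3mn+3n^2+3m+7n+2}\left[{N-m-3n-2\atop m}\right]_q\left[{\lfloor\frac{2(N-2)}3\rfloor-m-n\atop n}\right]_{q^3},$$ where the asterisk means that $\left[{-1\atop 0}\right]^*_q$ is understood as $1$, and $\delta_{3\mid(N-2)}$ is $1$ if $3\mid N-2$ and $0$ otherwise. Say that a partition $\lambda$ (possibly empty) satisfies $G_r$ if its parts at distance $2$ differ by at least $3$ and any two consecutive parts that differ by at most $1$ have a sum congruent to $r$ modulo $3$. The conditions $I_1,\dots,I_5$ on $\lambda$ are: $I_1$: $G_0$; $I_2$: $G_0$ and all parts are $\ge2$; $I_3$: $G_0$ and all parts are $\ge3$; $I_4$: $G_2$ and all parts are $\ge2$; $I_5$: $G_1$ and the part $2$ occurs at most once. **(a)** For $i=1,2,3,4$ and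 every $N\ge0$, and for $i=5$ and every $N\ge1$, $\mathrm{KR}_i(q,N)$ is the generating function $\sum_\lambda q^{|\lambda|}$ of the partitions into parts $\le N$ that satisfy $I_i$. **(b)** The polynomials satisfy the following recurrences. For a residue $r$ and a sequence $S_N=S_N(q)$, let $R_r(N)$ be the equation $$S_N=S_{N-1}+q^N\times\begin{cases}(1+q^{N-1})S_{N-3}+q^{N-2}S_{N-4}&\text{if }N\equiv r\pmod 3,\\ S_{N-2}+q^NS_{N-3}&\text{if }N\equiv r+1\pmod 3,\\ S_{N-2}&\text{if }N\equiv r+2\pmod 3.\end{cases}$$ Then: - $S_N=\mathrm{KR}_1(q,N)$ satisfies $R_2(N)$ for $N\ge1$, with $S_0=S_{-1}=1$ and $S_N=0$ for $N<-1$; - $S_N=\mathrm{KR}_2(q,N)$ satisfies $R_2(N)$ for $N\ge3$, with $S_0=S_1=1$ and $S_2=1+q^2$; - $S_N=\mathrm{KR}_3(q,N)$ satisfies $R_2(N)$ for $N\ge1$, with $S_0=1$ and $S_N=0$ for $N<0$; - $S_N=\mathrm{KR}_4(q,N)$ satisfies $R_0(N)$ for $N\ge1$, with $S_0=1$ and $S_N=0$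 for $N<0$; - $S_N=\mathrm{KR}_5(q,N)$ satisfies $R_1(N)$ for $N\ge5$, with $S_1=1+q$, $S_2=1+q+q^2$, $S_3=1+q+q^2+q^3+q^4$ and $S_4=1+q+q^2+q^3+2q^4+q^5+q^6+q^7+q^8$. **(c)** As $N\to\infty$, $\mathrm{KR}_i(q,N)$ tends coefficientwise to the formal power series $\mathrm{KR}_i(q)$, where $$\mathrm{KR}_1(q)=\sum_{m,n\ge0}\frac{q^{m^2+3mn+3n^2}}{(q;q)_m(q^3;q^3)_n},\quad \mathrm{KR}_2(q)=\sum_{m,n\ge0}\frac{q^{m^2+3mn+3n^2+m+3n}}{(q;q)_m(q^3;q^3)_n},\quad \mathrm{KR}_3(q)=\sum_{m,n\ge0}\frac{q^{m^2+3mn+3n^2+2m+3n}}{(q;q)_m(q^3;q^3)_n},$$ $$\mathrm{KR}_4(q)=\sum_{m,n\ge0}\frac{q^{m^2+3mn+3n^2+m+2n}}{(q;q)_m(q^3;q^3)_n},\quad \mathrm{KR}_5(q)=\sum_{m,n\ge0}\frac{q^{m^2+3mn+3n^2+2m+4n}(1+q+q^{m+3n+2})}{(q;q)_m(q^3;q^3)_n}$$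 (each double series converges coefficientwise), and $\mathrm{KR}_i(q)$ is the generating function of all partitions that satisfy $I_i$. **(d)** Call two consecutive parts that differ by at most $1$ a pair, and the parts that are in no pair singletons. (If $G_r$ holds, then no two pairs share a part.) For all $m,n,N\ge0$, the $(m,n)$-th summand of $\mathrm{KR}_4(q,N)$ is the generating function of the partitions into parts $\le N$ that satisfy $I_4$ and have exactly $n$ pairs and $m$ singletons; and the $(m,n)$-th summand of $\mathrm{KR}_4(q)$ is the generating function of all partitions that satisfy $I_4$ and have exactly $n$ pairs and $m$ singletons. -/

import Mathlib

open Polynomial Filter Topology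
open scoped PowerSeries.WithPiTopology

namespace KanadeRussell

/-! ### `q`-notation -/

/-- The `q`-shifted factorial `(a; q)_n = ∏_{j < n} (1 - a q^j)`. -/
def qPoch {R : Type*} [CommRing R] (a q : R) (n : ℕ) : R :=
  ∏ j ∈ Finset.range n, (1 - a * q ^ j)

/-- The Gaussian binomial coefficient with natural number arguments, as a polynomial expression
in the base `q`. It is given by the `q`-Pascal rule; `gaussBinom_mul` and
`gaussBinom_eq_zero` show that it is `(q;q)_N / ((q;q)_n (q;q)_{N-n})` for `0 ≤ n ≤ N` and `0`
for `n > N`. -/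
def gaussBinom {R : Type*} [CommRing R] (q : R) : ℕ → ℕ → R
  | _, 0 => 1
  | 0, _ + 1 => 0
  | N + 1, n + 1 => gaussBinom q N n + q ^ (n + 1) * gaussBinom q N (n + 1)

theorem gaussBinom_eq_zero {R : Type*} [CommRing R] (q : R) :
    ∀ N n : ℕ, N < n → gaussBinom q N n = 0
  | _, 0, h => absurd h (Nat.not_lt_zero _)
  | 0, _ + 1, _ => by simp [gaussBinom]
  | N + 1, n + 1, h => by
      rw [gaussBinom, gaussBinom_eq_zero q N n (by omega),
        gaussBinom_eq_zero q N (n + 1) (by omega)]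
      simp

theorem gaussBinom_add_mul {R : Type*} [CommRing R] (q : R) :
    ∀ n d : ℕ, gaussBinom q (n + d) n * (qPoch q q n * qPoch q q d) = qPoch q q (n + d)
  | 0, d => by
      have h : gaussBinom q (0 + d) 0 = 1 := by cases d <;> simp [gaussBinom]
      rw [h]; simp [qPoch]
  | n + 1, 0 => by
      have ih := gaussBinom_add_mul q n 0
      have e : gaussBinom q (n + 1 + 0) (n + 1)
          = gaussBinom q n n + q ^ (n + 1) * gaussBinom q n (n + 1) := by
        simp [gaussBinom]
      have s : qPoch q q (n + 1) = qPoch q q n * (1 - q * q ^ n) := Finset.prod_range_succ _ _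
      rw [e, gaussBinom_eq_zero q n (n + 1) (by omega)]
      have p0 : qPoch q q 0 = 1 := by simp [qPoch]
      simp only [Nat.add_zero, p0] at ih ⊢
      rw [s]
      linear_combination (1 - q * q ^ n) * ih
  | n + 1, d + 1 => by
      have ih1 := gaussBinom_add_mul q n (d + 1)
      have ih2 := gaussBinom_add_mul q (n + 1) d
      have e : gaussBinom q (n + 1 + (d + 1)) (n + 1)
          = gaussBinom q (n + (d + 1)) n
            + q ^ (n + 1) * gaussBinom q (n + 1 + d) (n + 1) := by
        have h1 : n + 1 + (d + 1) = (n + (d + 1)) + 1 := by omega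
        have h2 : n + 1 + d = n + (d + 1) := by omega
        rw [h1, h2, gaussBinom]
      have s : ∀ k, qPoch q q (k + 1) = qPoch q q k * (1 - q * q ^ k) :=
        fun k => Finset.prod_range_succ _ _
      have h3 : n + 1 + (d + 1) = (n + 1 + d) + 1 := by omega
      have h4 : n + (d + 1) = n + 1 + d := by omega
      rw [e, h3, s (n + 1 + d)]
      rw [h4] at ih1 ⊢
      rw [s d] at ih1 ⊢
      rw [s n] at ih2 ⊢
      rw [← sub_eq_zero] at ih1 ih2 ⊢
      linear_combination (1 - q * q ^ n) * ih1 + q ^ (n + 1) * (1 - q * q ^ d) * ih2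

theorem gaussBinom_mul {R : Type*} [CommRing R] (q : R) (N n : ℕ) (h : n ≤ N) :
    gaussBinom q N n * (qPoch q q n * qPoch q q (N - n)) = qPoch q q N := by
  obtain ⟨d, rfl⟩ := Nat.exists_eq_add_of_le h
  rw [Nat.add_sub_cancel_left]
  exact gaussBinom_add_mul q n d

/-- The `q`-binomial coefficient with an integer top argument; it is `0` unless
`0 ≤ n ≤ a`. -/
def qbin {R : Type*} [CommRing R] (q : R) (a : ℤ) (n : ℕ) : R :=
  if 0 ≤ a then gaussBinom q a.toNat n else 0

theorem qbin_eq_zero {R : Type*} [CommRing R] (q : R) (a : ℤ) (n : ℕ) (h : a < n) :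
    qbin q a n = 0 := by
  unfold qbin
  split_ifs with h0
  · exact gaussBinom_eq_zero q _ _ (by omega)
  · rfl

/-- The `q`-binomial coefficient, except that the one with top `-1` and bottom `0` is
understood as `1`. -/
def qbinStar {R : Type*} [CommRing R] (q : R) (a : ℤ) (n : ℕ) : R :=
  if a = -1 ∧ n = 0 then 1 else qbin q a n

/-! ### The finite double sums -/

/-- The `(m, n)`-th summand of `KR₁(q, N)`. -/
noncomputable def term1 (N : ℤ) (m n : ℕ) : ℤ[X] :=
  X ^ (m ^ 2 + 3 * m * n + 3 * n ^ 2)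
    * qbin X (N - m - 3 * n + 1) m * qbin (X ^ 3) (2 * N / 3 - m - n + 1) n

/-- The `(m, n)`-th summand of `KR₂(q, N)`. -/
noncomputable def term2 (N : ℤ) (m n : ℕ) : ℤ[X] :=
  X ^ (m ^ 2 + 3 * m * n + 3 * n ^ 2 + m + 3 * n)
    * qbin X (N - m - 3 * n) m * qbin (X ^ 3) (2 * N / 3 - m - n) n

/-- The `(m, n)`-th summand of `KR₃(q, N)`. -/
noncomputable def term3 (N : ℤ) (m n : ℕ) : ℤ[X] :=
  X ^ (m ^ 2 + 3 * m * n + 3 * n ^ 2 + 2 * m + 3 * n)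
    * qbinStar X (N - m - 3 * n - 1) m * qbin (X ^ 3) (2 * N / 3 - m - n) n

/-- The `(m, n)`-th summand of `KR₄(q, N)`. -/
noncomputable def term4 (N : ℤ) (m n : ℕ) : ℤ[X] :=
  X ^ (m ^ 2 + 3 * m * n + 3 * n ^ 2 + m + 2 * n)
    * qbin X (N - m - 3 * n) m * qbin (X ^ 3) (2 * (N - 1) / 3 - m - n + 1) n

/-- The `(m, n)`-th summand of `KR₅(q, N)`, the two double sums being taken together. -/
noncomputable def term5 (N : ℤ) (m n : ℕ) : ℤ[X] :=
  X ^ (m ^ 2 + 3 * m * n + 3 * n ^ 2 + 2 * m + 4 * n) * (1 + X)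
    * qbin X (N - m - 3 * n - 1) m
    * qbin (X ^ 3) (2 * (N - 1) / 3 - m - n + (if (3 : ℤ) ∣ N - 2 then 1 else 0)) n
  + X ^ (m ^ 2 + 3 * m * n + 3 * n ^ 2 + 3 * m + 7 * n + 2)
    * qbin X (N - m - 3 * n - 2) m
    * qbin (X ^ 3) (2 * (N - 2) / 3 - m - n) n

/-- The double sum over all `m, n ≥ 0` of `t N m n`. The range of summation is finite because
all the other summands vanish; see `term1_eq_zero`, …, `term5_eq_zero`. -/
noncomputable def doubleSum (t : ℤ → ℕ → ℕ → ℤ[X]) (N : ℤ) : ℤ[X] :=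
  ∑ m ∈ Finset.range (N.toNat + 2), ∑ n ∈ Finset.range (N.toNat + 2), t N m n

theorem term1_eq_zero (N : ℤ) (m n : ℕ) (h : N.toNat + 2 ≤ m ∨ N.toNat + 2 ≤ n) :
    term1 N m n = 0 := by
  rw [term1, qbin_eq_zero X _ m (by omega)]; simp

theorem term2_eq_zero (N : ℤ) (m n : ℕ) (h : N.toNat + 2 ≤ m ∨ N.toNat + 2 ≤ n) :
    term2 N m n = 0 := by
  rw [term2, qbin_eq_zero X _ m (by omega)]; simp

theorem term3_eq_zero (N : ℤ) (m n : ℕ) (h : N.toNat + 2 ≤ m ∨ N.toNat + 2 ≤ n) :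
    term3 N m n = 0 := by
  rw [term3, qbinStar, if_neg (by omega), qbin_eq_zero X _ m (by omega)]; simp

theorem term4_eq_zero (N : ℤ) (m n : ℕ) (h : N.toNat + 2 ≤ m ∨ N.toNat + 2 ≤ n) :
    term4 N m n = 0 := by
  rw [term4, qbin_eq_zero X _ m (by omega)]; simp

theorem term5_eq_zero (N : ℤ) (m n : ℕ) (h : N.toNat + 2 ≤ m ∨ N.toNat + 2 ≤ n) :
    term5 N m n = 0 := by
  rw [term5, qbin_eq_zero X (N - m - 3 * n - 1) m (by omega),
    qbin_eq_zero X (N - m - 3 * n - 2) m (by omega)]; simp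

noncomputable def KR1 (N : ℤ) : ℤ[X] := doubleSum term1 N
noncomputable def KR2 (N : ℤ) : ℤ[X] := doubleSum term2 N
noncomputable def KR3 (N : ℤ) : ℤ[X] := doubleSum term3 N
noncomputable def KR4 (N : ℤ) : ℤ[X] := doubleSum term4 N
noncomputable def KR5 (N : ℤ) : ℤ[X] := doubleSum term5 N

/-! ### The infinite double series -/

/-- The denominator `(q; q)_m (q³; q³)_n` as a formal power series. -/
noncomputable def denom (m n : ℕ) : PowerSeries ℤ :=
  qPoch PowerSeries.X PowerSeries.X m * qPoch (PowerSeries.X ^ 3) (PowerSeries.X ^ 3) n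

/-- The formal power series `1 / ((q; q)_m (q³; q³)_n)`. -/
noncomputable def invDenom (m n : ℕ) : PowerSeries ℤ :=
  PowerSeries.invOfUnit (denom m n) 1

theorem denom_mul_invDenom (m n : ℕ) : denom m n * invDenom m n = 1 := by
  refine PowerSeries.mul_invOfUnit _ _ ?_
  simp [denom, qPoch, map_prod]

noncomputable def serTerm1 (p : ℕ × ℕ) : PowerSeries ℤ :=
  PowerSeries.X ^ (p.1 ^ 2 + 3 * p.1 * p.2 + 3 * p.2 ^ 2) * invDenom p.1 p.2

noncomputable def serTerm2 (p : ℕ × ℕ) : PowerSeries ℤ :=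
  PowerSeries.X ^ (p.1 ^ 2 + 3 * p.1 * p.2 + 3 * p.2 ^ 2 + p.1 + 3 * p.2) * invDenom p.1 p.2

noncomputable def serTerm3 (p : ℕ × ℕ) : PowerSeries ℤ :=
  PowerSeries.X ^ (p.1 ^ 2 + 3 * p.1 * p.2 + 3 * p.2 ^ 2 + 2 * p.1 + 3 * p.2) * invDenom p.1 p.2

noncomputable def serTerm4 (p : ℕ × ℕ) : PowerSeries ℤ :=
  PowerSeries.X ^ (p.1 ^ 2 + 3 * p.1 * p.2 + 3 * p.2 ^ 2 + p.1 + 2 * p.2) * invDenom p.1 p.2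

noncomputable def serTerm5 (p : ℕ × ℕ) : PowerSeries ℤ :=
  PowerSeries.X ^ (p.1 ^ 2 + 3 * p.1 * p.2 + 3 * p.2 ^ 2 + 2 * p.1 + 4 * p.2)
    * (1 + PowerSeries.X + PowerSeries.X ^ (p.1 + 3 * p.2 + 2)) * invDenom p.1 p.2

/-- The polynomials `S N` converge, coefficientwise as `N → ∞`, to the formal power series
`∑_{m, n ≥ 0} t (m, n)`, which itself converges coefficientwise. -/
def TendsToSeries (S : ℤ → ℤ[X]) (t : ℕ × ℕ → PowerSeries ℤ) : Prop :=
  Summable t ∧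
    Tendsto (fun N : ℕ => ((S (N : ℤ) : ℤ[X]) : PowerSeries ℤ)) atTop (𝓝 (∑' p, t p))

/-! ### Partitions and gap conditions -/

/-- The parts of a partition in non-decreasing order. -/
def sortedParts {k : ℕ} (p : k.Partition) : List ℕ := p.parts.sort (· ≤ ·)

/-- The difference of parts at distance `2` is at least `3`, and two consecutive parts that
differ by at most `1` have a sum congruent to `r` modulo `3`. -/
def GapCond (r : ℕ) {k : ℕ} (p : k.Partition) : Prop :=
  (∀ (i : ℕ) (h : i + 2 < (sortedParts p).length),
      (sortedParts p)[i] + 3 ≤ (sortedParts p)[i + 2]) ∧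
  (∀ (i : ℕ) (h : i + 1 < (sortedParts p).length),
      (sortedParts p)[i + 1] - (sortedParts p)[i] ≤ 1 →
      (sortedParts p)[i] + (sortedParts p)[i + 1] ≡ r [MOD 3])

def I1 {k : ℕ} (p : k.Partition) : Prop := GapCond 0 p

def I2 {k : ℕ} (p : k.Partition) : Prop := GapCond 0 p ∧ ∀ x ∈ p.parts, 2 ≤ x

def I3 {k : ℕ} (p : k.Partition) : Prop := GapCond 0 p ∧ ∀ x ∈ p.parts, 3 ≤ x

def I4 {k : ℕ} (p : k.Partition) : Prop := GapCond 2 p ∧ ∀ x ∈ p.parts, 2 ≤ x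

/-- Here `2 + 2` is not allowed to occur in the partition. -/
def I5 {k : ℕ} (p : k.Partition) : Prop := GapCond 1 p ∧ p.parts.count 2 ≤ 1

/-- The number of pairs: consecutive parts that differ by at most `1`. -/
noncomputable def numPairs {k : ℕ} (p : k.Partition) : ℕ :=
  Nat.card {i : ℕ // ∃ h : i + 1 < (sortedParts p).length,
    (sortedParts p)[i + 1] - (sortedParts p)[i] ≤ 1}

/-- `p` has exactly `n` pairs and, besides the `2n` parts in pairs, exactly `m` singletons. -/
def HasType (m n : ℕ) {k : ℕ} (p : k.Partition) : Prop :=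
  numPairs p = n ∧ Multiset.card p.parts = m + 2 * n

/-- All parts are at most `N`. -/
def PartsLE (N : ℕ) {k : ℕ} (p : k.Partition) : Prop := ∀ x ∈ p.parts, x ≤ N

/-- The formal power series `f` is the generating function `∑_k #{p ⊢ k : P p} q^k` of the
partitions with the property `P`. -/
def IsGenFun (f : PowerSeries ℤ) (P : ∀ {k : ℕ}, k.Partition → Prop) : Prop :=
  ∀ k : ℕ, PowerSeries.coeff k f = (Nat.card {p : k.Partition // P p} : ℤ)

/-! ### Recurrences -/

/-- The recurrence at `N` given by the largest part `N`; `r` is the residue class modulo `3`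
of those `N` for which `{N - 1, N}` is an admissible pair (and `{N, N}` is one for
`N ≡ r + 1`). -/
def Recurrence (r : ℕ) (S : ℤ → ℤ[X]) (N : ℕ) : Prop :=
  S N = S (N - 1) + X ^ N *
    (if N % 3 = r % 3 then (1 + X ^ (N - 1)) * S (N - 3) + X ^ (N - 2) * S (N - 4)
     else if N % 3 = (r + 1) % 3 then S (N - 2) + X ^ N * S (N - 3)
     else S (N - 2))

end KanadeRussell

namespace KanadeRussell

/-! ### `q`-Pascal rules -/

/-! The double sums and the partition generating functions satisfy the same recurrence, obtained by
removing the largest part, and they agree for small `N`. For `KR1` to `KR4` this holds already for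
each summand: the `(m, n)`-th summand counts the partitions with `n` pairs and `m` singletons.

On the analytic side, lowering `N` by one lowers the top of the first `q`-binomial and, unless `N ≡
1 [MOD 3]`, that of the second. In the first three sums, the Pascal rule in base `q^3` splits off
`q^(3⌊2N/3⌋)`, which is `q^(2N)` or `q^(2N-1)`: the weight of the pair `{N, N}` or `{N - 1, N}`. The
Pascal rule in base `q` splits off `q^N`, a singleton `N`. These sums are treated together as
`genTerm`. Adding `1` to all parts multiplies a summand by `q^(m+2n)` and moves the residue class of
the recurrence; this gives `term4` from `term1`, and `term5` as a combination of lifts of `term4`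
and `term2`. Summation over `m` and `n` turns `TermRecurrence` into `Recurrence`.

On the combinatorial side, an admissible partition is a non-increasing list. The residue of `N`
decides which of `{N, N}` and `{N - 1, N}` may occur, hence what may follow a largest part `N`
(`tail_mem_two`, `tail_mem_one`, `tail_mem_zero`). This gives the recurrence `sum_adm`, and
`eq_typeSum` identifies the two sides by induction. For `KR5` only the totals are compared
(`KR5_eq_sumFive`).

For the limit, each Gaussian binomial tends to `1 / (q; q)_n`, and a fixed coefficient involves only
finitely many summands. A partition of `k` has all parts at most `k`, so the bound on the parts
disappears in the limit. -/

theorem gaussBinom_zero {R : Type*} [CommRing R] (q : R) (N : ℕ) : gaussBinom q N 0 = 1 := by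
  cases N <;> simp [gaussBinom]

theorem gaussBinom_succ {R : Type*} [CommRing R] (q : R) (N n : ℕ) :
    gaussBinom q (N + 1) (n + 1) = gaussBinom q N n + q ^ (n + 1) * gaussBinom q N (n + 1) := by
  rw [gaussBinom]

/-- The second `q`-Pascal rule. -/
theorem gaussBinom_succ' {R : Type*} [CommRing R] (q : R) (N n : ℕ) :
    gaussBinom q (N + 1) (n + 1) = gaussBinom q N (n + 1) + q ^ (N - n) * gaussBinom q N n := by
  induction N generalizing n with
  | zero =>
    cases n with
    | zero => simp [gaussBinom]
    | succ n => simp [gaussBinom]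
  | succ N ih =>
    rcases Nat.lt_or_ge (N + 1) n with h | h
    · rw [gaussBinom_eq_zero q (N + 1 + 1) (n + 1) (by omega),
        gaussBinom_eq_zero q (N + 1) (n + 1) (by omega), gaussBinom_eq_zero q (N + 1) n h]
      simp
    · rw [gaussBinom_succ q (N + 1) n]
      cases n with
      | zero =>
        have h1 := gaussBinom_succ q N 0
        have h2 := ih 0
        simp only [gaussBinom_zero, Nat.sub_zero, Nat.zero_add] at *
        rw [pow_succ q N]
        linear_combination q * h2 - h1
      | succ n =>
        obtain ⟨d, hd⟩ := Nat.exists_eq_add_of_le h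
        have hN : N = n + d := by omega
        have h1 := ih n
        have h2 := ih (n + 1)
        have h3 := gaussBinom_succ q N (n + 1)
        have h4 := gaussBinom_succ q N n
        have e1 : N - n = d := by omega
        have e2 : N + 1 - (n + 1) = d := by omega
        rw [e1] at h1
        rw [e2]
        -- For `d = 0` the exponent `N - (n + 1)` is truncated and `e4` would be false.
        rcases Nat.eq_zero_or_pos d with hd0 | hd0
        · subst hd0
          rw [gaussBinom_eq_zero q (N + 1) (n + 1 + 1) (by omega)]
          simp
        · have e4 : q ^ (n + 1 + 1) * q ^ (N - (n + 1)) = q ^ (n + 1) * q ^ d := by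
            rw [← pow_add, ← pow_add]; congr 1; omega
          linear_combination h1 + q ^ (n + 1 + 1) * h2 - h3 - q ^ d * h4
            + gaussBinom q N (n + 1) * e4

theorem qbin_zero {R : Type*} [CommRing R] (q : R) (a : ℤ) :
    qbin q a 0 = if 0 ≤ a then 1 else 0 := by
  simp [qbin, gaussBinom_zero]

/-- This form of the Pascal rule is the one needed, since its exponent contains the top argument and
hence `N`. It holds for every integer top: for `a ≤ 0` all terms vanish. -/
theorem qbin_succ {R : Type*} [CommRing R] (q : R) (a : ℤ) (n : ℕ) :
    qbin q a (n + 1) = qbin q (a - 1) (n + 1) + q ^ (a - 1 - n).toNat * qbin q (a - 1) n := by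
  rcases lt_or_ge a 1 with h | h
  · rw [qbin_eq_zero q a (n + 1) (by push_cast; omega),
      qbin_eq_zero q (a - 1) (n + 1) (by push_cast; omega),
      qbin_eq_zero q (a - 1) n (by omega)]
    simp
  · obtain ⟨N, rfl⟩ : ∃ N : ℕ, a = N + 1 := ⟨(a - 1).toNat, by omega⟩
    have e1 : (N + 1 : ℤ).toNat = N + 1 := by omega
    have e2 : (N + 1 - 1 - n : ℤ).toNat = N - n := by omega
    rw [qbin, qbin, qbin, if_pos (by omega), if_pos (by omega), if_pos (by omega), e1, e2]
    simpa using gaussBinom_succ' q N n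

theorem qbinStar_eq_zero {R : Type*} [CommRing R] (q : R) (a : ℤ) (n : ℕ) (h : a < n)
    (h' : ¬(a = -1 ∧ n = 0)) : qbinStar q a n = 0 := by
  rw [qbinStar, if_neg h', qbin_eq_zero q a n h]

theorem qbinStar_succ {R : Type*} [CommRing R] (q : R) (a : ℤ) (n : ℕ) (h : ¬(a = 0 ∧ n = 0)) :
    qbinStar q a (n + 1)
      = qbinStar q (a - 1) (n + 1) + q ^ (a - 1 - n).toNat * qbinStar q (a - 1) n := by
  rw [qbinStar, qbinStar, qbinStar, if_neg (by omega), if_neg (by omega), if_neg (by omega),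
    qbin_succ]

theorem qbinStar_zero {R : Type*} [CommRing R] (q : R) (a : ℤ) :
    qbinStar q a 0 = if -1 ≤ a then 1 else 0 := by
  rw [qbinStar, qbin_zero]
  split_ifs <;> first | rfl | omega

/-! ### The recurrence for the summands -/

/-- Shift in the first index. -/
noncomputable def shiftFst (f : ℕ → ℕ → ℤ[X]) : ℕ → ℕ → ℤ[X]
  | 0, _ => 0
  | m + 1, n => f m n

/-- Shift in the second index. -/
noncomputable def shiftSnd (f : ℕ → ℕ → ℤ[X]) : ℕ → ℕ → ℤ[X]
  | _, 0 => 0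
  | m, n + 1 => f m n

/-- The right side of the recurrence for the summands, apart from `T (N - 1) m n`. -/
noncomputable def topTerms (r : ℕ) (T : ℤ → ℕ → ℕ → ℤ[X]) (N : ℕ) (m n : ℕ) : ℤ[X] :=
  if N % 3 = r % 3 then shiftFst (T (N - 3)) m n + X ^ (N - 1) * shiftSnd (T (N - 3)) m n
    + X ^ (N - 2) * shiftFst (shiftFst (T (N - 4))) m n
  else if N % 3 = (r + 1) % 3 then shiftFst (T (N - 2)) m n + X ^ N * shiftSnd (T (N - 3)) m n
  else shiftFst (T (N - 2)) m n

/-- The recurrence for the summands. -/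
def TermRecurrence (r : ℕ) (T : ℤ → ℕ → ℕ → ℤ[X]) (N : ℕ) : Prop :=
  ∀ m n : ℕ, T N m n = T (N - 1) m n + X ^ N * topTerms r T N m n

/-- A common form of the summands of the first three double sums. -/
noncomputable def genTerm (α δ : ℕ) (N : ℤ) (m n : ℕ) : ℤ[X] :=
  X ^ (m ^ 2 + 3 * m * n + 3 * n ^ 2 + α * m + 3 * δ * n)
    * (qbinStar X (N - m - 3 * n + 1 - α) m * qbin (X ^ 3) (2 * N / 3 - m - n + 1 - δ) n)

/-- The starred convention breaks the Pascal rule exactly at `a = 0`, `m = 0`, where it would read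
`0 = 0 + 1`. In the applications `B` is the second `q`-binomial, which vanishes there. -/
theorem qbinStar_mul_succ (a : ℤ) (m : ℕ) (B : ℤ[X]) (h : a = 0 ∧ m = 0 → B = 0) :
    qbinStar X a (m + 1) * B = qbinStar X (a - 1) (m + 1) * B
      + X ^ (a - 1 - m).toNat * (qbinStar X (a - 1) m * B) := by
  by_cases h' : a = 0 ∧ m = 0
  · simp [h h']
  · rw [qbinStar_succ _ _ _ h']; ring

theorem qbinStar_mul_zero (a : ℤ) (B : ℤ[X]) (h : a = -1 → B = 0) :
    qbinStar X a 0 * B = qbinStar X (a - 1) 0 * B := by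
  rw [qbinStar_zero, qbinStar_zero]
  split_ifs with h1 h2 h2
  · rfl
  · rw [h (by omega)]; simp
  · omega
  · rfl

/-- Exponents need to be compared only where the product of the `q`-binomials is nonzero; there the
truncated `toNat` is a true difference. -/
theorem pow_mul_eq_pow_mul {R : Type*} [CommRing R] {q P : R} {i j : ℕ} (h : P = 0 ∨ i = j) :
    q ^ i * P = q ^ j * P := by
  rcases h with h | h <;> simp [h]

/-- The parameters of `genTerm` that occur, with the range of validity of the recurrence. -/
def GoodParam (α δ N : ℕ) : Prop :=
  (α = 0 ∧ δ = 0) ∨ (α = 1 ∧ δ = 1 ∧ 3 ≤ N) ∨ (α = 2 ∧ δ = 1 ∧ 1 ≤ N)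

theorem qbinStar_mul_qbin_eq_zero {a b : ℤ} {m n : ℕ}
    (h : (a < m ∧ ¬(a = -1 ∧ m = 0)) ∨ b < n) :
    (qbinStar X a m * qbin (X ^ 3) b n : ℤ[X]) = 0 := by
  rcases h with h | h
  · rw [qbinStar_eq_zero _ _ _ h.1 h.2, zero_mul]
  · rw [qbin_eq_zero _ _ _ h, mul_zero]

theorem genTerm_eq {α δ : ℕ} {N : ℤ} {m n : ℕ} {a b : ℤ} (ha : N - m - 3 * n + 1 - α = a)
    (hb : 2 * N / 3 - m - n + 1 - δ = b) :
    genTerm α δ N m n = X ^ (m ^ 2 + 3 * m * n + 3 * n ^ 2 + α * m + 3 * δ * n)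
      * (qbinStar X a m * qbin (X ^ 3) b n) := by
  rw [genTerm, ha, hb]

/-- For `N ≡ 1 [MOD 3]` the floors `⌊2N/3⌋` and `⌊2(N-1)/3⌋` agree, so only the first `q`-binomial
is expanded. No pair has largest part `N` in this class. -/
theorem genTerm_rec_one {α δ N : ℕ} (h : GoodParam α δ N) (hN : N % 3 = 1) (m n : ℕ) :
    genTerm α δ N m n
      = genTerm α δ (N - 1) m n + X ^ N * shiftFst (genTerm α δ (N - 2)) m n := by
  obtain ⟨k, rfl⟩ : ∃ k, N = 3 * k + 1 := ⟨N / 3, by omega⟩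
  obtain ⟨a, ha⟩ : ∃ a : ℤ, ((3 * k + 1 : ℕ) : ℤ) - m - 3 * n + 1 - α = a := ⟨_, rfl⟩
  obtain ⟨b, hb⟩ : ∃ b : ℤ, (2 * ((3 * k + 1 : ℕ) : ℤ)) / 3 - m - n + 1 - δ = b := ⟨_, rfl⟩
  rw [genTerm_eq ha hb, genTerm_eq (a := a - 1) (b := b) (by omega) (by omega)]
  unfold GoodParam at h
  cases m with
  | zero =>
    rw [shiftFst, qbinStar_mul_zero a _ fun h0 => qbin_eq_zero _ _ _ (by omega)]
    ring
  | succ m =>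
    rw [shiftFst, genTerm_eq (N := ((3 * k + 1 : ℕ) : ℤ) - 2) (a := a - 1) (b := b) (by omega)
      (by omega), qbinStar_mul_succ a _ _ fun h0 => qbin_eq_zero _ _ _ (by omega), mul_add,
      ← mul_assoc (X ^ _) (X ^ _), ← mul_assoc (X ^ _) (X ^ _), ← pow_add, ← pow_add]
    congr 1
    refine pow_mul_eq_pow_mul ?_
    by_cases h1 : (a - 1 < m ∧ ¬(a - 1 = -1 ∧ m = 0)) ∨ b < n
    · exact Or.inl (qbinStar_mul_qbin_eq_zero h1)
    · right
      obtain ⟨d, hd⟩ : ∃ d : ℕ, a - 1 - m = d := ⟨(a - 1 - m).toNat, by omega⟩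
      rw [hd, Int.toNat_natCast]
      have : 3 * k + 1 = 2 * m + 1 + 3 * n + α + d := by omega
      linarith

theorem qbinStar_mul_qbin_succ (A : ℤ[X]) (b : ℤ) (n : ℕ) :
    A * qbin (X ^ 3) b (n + 1) = A * qbin (X ^ 3) (b - 1) (n + 1)
      + X ^ (3 * (b - 1 - n).toNat) * (A * qbin (X ^ 3) (b - 1) n) := by
  rw [qbin_succ, ← pow_mul]; ring

/-- The Pascal rule for the second `q`-binomial splits off a pair with largest part `N`: `{N, N}` if
`3 ∣ N`, and `{N - 1, N}` if `N ≡ 2 [MOD 3]`. -/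
theorem genTerm_rec_snd {α δ N : ℕ} (h : GoodParam α δ N) (hN : N % 3 ≠ 1) (m n : ℕ) {a b : ℤ}
    (ha : (N : ℤ) - m - 3 * n + 1 - α = a) (hb : 2 * (N : ℤ) / 3 - m - n + 1 - δ = b) :
    genTerm α δ N m n = X ^ (m ^ 2 + 3 * m * n + 3 * n ^ 2 + α * m + 3 * δ * n)
      * (qbinStar X a m * qbin (X ^ 3) (b - 1) n)
      + X ^ N * (X ^ (if N % 3 = 0 then N else N - 1)
        * shiftSnd (genTerm α δ (N - 3)) m n) := by
  rw [genTerm_eq ha hb]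
  unfold GoodParam at h
  cases n with
  | zero =>
    simp only [shiftSnd, mul_zero, add_zero]
    congr 1
    rw [qbin_zero, qbin_zero]
    split_ifs with h1 h2 h2
    · rfl
    -- The two sides could differ only for `b = 0`, and then the first factor vanishes.
    · rw [qbinStar_eq_zero _ _ _ (by omega) (by omega)]; simp
    · omega
    · rfl
  | succ n =>
    rw [shiftSnd, genTerm_eq (N := (N : ℤ) - 3) (a := a) (b := b - 1) (by push_cast at *; omega)
      (by push_cast at *; omega), qbinStar_mul_qbin_succ, mul_add]
    congr 1
    rw [← mul_assoc (X ^ _) (X ^ _), ← mul_assoc (X ^ N) (X ^ _), ← mul_assoc (X ^ N * X ^ _),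
      ← pow_add, ← pow_add, ← pow_add]
    refine pow_mul_eq_pow_mul ?_
    by_cases h1 : (a < m ∧ ¬(a = -1 ∧ m = 0)) ∨ b - 1 < n
    · exact Or.inl (qbinStar_mul_qbin_eq_zero h1)
    · right
      obtain ⟨d, hd⟩ : ∃ d : ℕ, b - 1 - n = d := ⟨(b - 1 - n).toNat, by omega⟩
      rw [hd, Int.toNat_natCast]
      -- Both sides are `3⌊2N/3⌋`.
      have : N + (if N % 3 = 0 then N else N - 1) = 3 * (m + 2 * n + 1 + δ + d) := by
        split_ifs <;> omega
      linarith

/-- After the pair `{N, N}` has been split off, the first `q`-binomial is expanded once, for a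
singleton `N`. -/
theorem genTerm_rec_zero {α δ N : ℕ} (h : GoodParam α δ N) (hN : N % 3 = 0) (m n : ℕ) :
    genTerm α δ N m n
      = genTerm α δ (N - 1) m n + X ^ N * (shiftFst (genTerm α δ (N - 2)) m n
        + X ^ N * shiftSnd (genTerm α δ (N - 3)) m n) := by
  obtain ⟨a, ha⟩ : ∃ a : ℤ, (N : ℤ) - m - 3 * n + 1 - α = a := ⟨_, rfl⟩
  obtain ⟨b, hb⟩ : ∃ b : ℤ, 2 * (N : ℤ) / 3 - m - n + 1 - δ = b := ⟨_, rfl⟩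
  rw [genTerm_rec_snd h (by omega) m n ha hb, if_pos hN,
    genTerm_eq (N := (N : ℤ) - 1) (a := a - 1) (b := b - 1) (by omega) (by omega), mul_add,
    ← add_assoc]
  congr 1
  unfold GoodParam at h
  cases m with
  | zero =>
    rw [shiftFst, qbinStar_mul_zero a _ fun h0 => qbin_eq_zero _ _ _ (by omega)]
    ring
  | succ m =>
    rw [shiftFst, genTerm_eq (N := (N : ℤ) - 2) (a := a - 1) (b := b - 1) (by omega)
      (by omega), qbinStar_mul_succ a _ _ fun h0 => qbin_eq_zero _ _ _ (by omega), mul_add,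
      ← mul_assoc (X ^ _) (X ^ _), ← mul_assoc (X ^ _) (X ^ _), ← pow_add, ← pow_add]
    congr 1
    refine pow_mul_eq_pow_mul ?_
    by_cases h1 : (a - 1 < m ∧ ¬(a - 1 = -1 ∧ m = 0)) ∨ b - 1 < n
    · exact Or.inl (qbinStar_mul_qbin_eq_zero h1)
    · right
      obtain ⟨d, hd⟩ : ∃ d : ℕ, a - 1 - m = d := ⟨(a - 1 - m).toNat, by omega⟩
      rw [hd, Int.toNat_natCast]
      have : N = 2 * m + 1 + 3 * n + α + d := by omega
      linarith

/-- After the pair `{N - 1, N}` has been split off, the first `q`-binomial is expanded twice: once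
for a singleton `N`, and then the resulting term once more, for a second singleton `N - 2`. -/
theorem genTerm_rec_two {α δ N : ℕ} (h : GoodParam α δ N) (hN : N % 3 = 2) (m n : ℕ) :
    genTerm α δ N m n
      = genTerm α δ (N - 1) m n + X ^ N * (shiftFst (genTerm α δ (N - 3)) m n
        + X ^ (N - 1) * shiftSnd (genTerm α δ (N - 3)) m n
        + X ^ (N - 2) * shiftFst (shiftFst (genTerm α δ (N - 4))) m n) := by
  obtain ⟨a, ha⟩ : ∃ a : ℤ, (N : ℤ) - m - 3 * n + 1 - α = a := ⟨_, rfl⟩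
  obtain ⟨b, hb⟩ : ∃ b : ℤ, 2 * (N : ℤ) / 3 - m - n + 1 - δ = b := ⟨_, rfl⟩
  rw [genTerm_rec_snd h (by omega) m n ha hb, if_neg (by omega),
    genTerm_eq (N := (N : ℤ) - 1) (a := a - 1) (b := b - 1) (by omega) (by omega), mul_add, mul_add,
    add_right_comm (X ^ N * _), ← add_assoc]
  congr 1
  unfold GoodParam at h
  cases m with
  | zero =>
    rw [shiftFst, shiftFst, qbinStar_mul_zero a _ fun h0 => qbin_eq_zero _ _ _ (by omega)]
    ring
  | succ m =>
    rw [shiftFst, shiftFst, genTerm_eq (N := (N : ℤ) - 3) (a := a - 2) (b := b - 1) (by omega)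
      (by omega), qbinStar_mul_succ a _ _ fun h0 => qbin_eq_zero _ _ _ (by omega), mul_add]
    congr 1
    -- The factor `X ^ N` of the singleton `N` is extracted first; what remains has top `a - 1`, one
    -- more than in the summand for `N - 3`, and is expanded again.
    have e1 : X ^ ((m + 1) ^ 2 + 3 * (m + 1) * n + 3 * n ^ 2 + α * (m + 1) + 3 * δ * n)
        * (X ^ (a - 1 - m).toNat * (qbinStar X (a - 1) m * qbin (X ^ 3) (b - 1) n))
        = X ^ N * (X ^ (m ^ 2 + 3 * m * n + 3 * n ^ 2 + α * m + 3 * δ * n)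
          * (qbinStar X (a - 1) m * qbin (X ^ 3) (b - 1) n : ℤ[X])) := by
      rw [← mul_assoc (X ^ _) (X ^ _), ← mul_assoc (X ^ _) (X ^ _), ← pow_add, ← pow_add]
      refine pow_mul_eq_pow_mul ?_
      by_cases h1 : (a - 1 < m ∧ ¬(a - 1 = -1 ∧ m = 0)) ∨ b - 1 < n
      · exact Or.inl (qbinStar_mul_qbin_eq_zero h1)
      · right
        obtain ⟨d, hd⟩ : ∃ d : ℕ, a - 1 - m = d := ⟨(a - 1 - m).toNat, by omega⟩
        rw [hd, Int.toNat_natCast]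
        have : N = 2 * m + 1 + 3 * n + α + d := by omega
        linarith
    rw [e1, ← mul_add]
    congr 1
    have e2 : a - 2 = a - 1 - 1 := by ring
    rw [e2]
    cases m with
    | zero =>
      rw [shiftFst, mul_zero (X ^ (N - 2)), add_zero (X ^ _ * _),
        qbinStar_mul_zero (a - 1) _ fun h0 => qbin_eq_zero _ _ _ (by omega)]
    | succ m =>
      rw [shiftFst, genTerm_eq (N := (N : ℤ) - 4) (a := a - 1 - 1) (b := b - 1) (by omega)
        (by omega), qbinStar_mul_succ (a - 1) _ _ fun h0 => qbin_eq_zero _ _ _ (by omega), mul_add]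
      congr 1
      rw [← mul_assoc (X ^ _) (X ^ _), ← mul_assoc (X ^ _) (X ^ _), ← pow_add, ← pow_add]
      refine pow_mul_eq_pow_mul ?_
      by_cases h1 : (a - 1 - 1 < m ∧ ¬(a - 1 - 1 = -1 ∧ m = 0)) ∨ b - 1 < n
      · exact Or.inl (qbinStar_mul_qbin_eq_zero h1)
      · right
        obtain ⟨d, hd⟩ : ∃ d : ℕ, a - 1 - 1 - m = d := ⟨(a - 1 - 1 - m).toNat, by omega⟩
        rw [hd, Int.toNat_natCast]
        have : N - 2 = 2 * m + 1 + 3 * n + α + d := by omega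
        rw [this]
        ring

theorem termRecurrence_genTerm {α δ N : ℕ} (h : GoodParam α δ N) :
    TermRecurrence 2 (genTerm α δ) N := by
  intro m n
  unfold topTerms
  split_ifs with h1 h2
  · exact genTerm_rec_two h h1 m n
  · exact genTerm_rec_zero h h2 m n
  · exact genTerm_rec_one h (by omega) m n

/-- The star makes no difference here: when the top is `-1` and `m = 0`, we have `N = 3n - 2`, and
the second `q`-binomial has top `n - 1` and vanishes. For `term2` the same happens with `N = 3n -
1`. For `term3` the exception `N = 3n` survives; it accounts for the partition `3, 3, 6, 6, …, 3n,
3n`. -/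
theorem term1_eq_genTerm (N : ℤ) (m n : ℕ) : term1 N m n = genTerm 0 0 N m n := by
  rw [term1, genTerm, qbinStar]
  split_ifs with h
  · rw [qbin_eq_zero (X ^ 3) (2 * N / 3 - m - n + 1) n (by omega),
      qbin_eq_zero (X ^ 3) _ n (by omega)]
    simp
  · simp [mul_assoc]

theorem term2_eq_genTerm (N : ℤ) (m n : ℕ) : term2 N m n = genTerm 1 1 N m n := by
  rw [term2, genTerm, qbinStar]
  split_ifs with h
  · rw [qbin_eq_zero (X ^ 3) (2 * N / 3 - m - n) n (by omega),
      qbin_eq_zero (X ^ 3) _ n (by omega)]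
    simp
  · simp [mul_assoc]

theorem term3_eq_genTerm (N : ℤ) (m n : ℕ) : term3 N m n = genTerm 2 1 N m n := by
  rw [term3, genTerm, show (N - m - 3 * n - 1 : ℤ) = N - m - 3 * n + 1 - (2 : ℕ) by push_cast; ring,
    show (2 * N / 3 - m - n : ℤ) = 2 * N / 3 - m - n + 1 - (1 : ℕ) by push_cast; ring]
  ring_nf

/-- Adding `1` to all the parts. -/
noncomputable def liftTerm (T : ℤ → ℕ → ℕ → ℤ[X]) (N : ℤ) (m n : ℕ) : ℤ[X] :=
  X ^ (m + 2 * n) * T (N - 1) m n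

theorem term4_eq (N : ℤ) (m n : ℕ) : term4 N m n = liftTerm term1 N m n := by
  rw [term4, liftTerm, term1, show (N - m - 3 * n : ℤ) = N - 1 - m - 3 * n + 1 by ring]
  ring

/-- This matches a case distinction on small parts under `I5`. Without a part `2`, the part `1` is
optional (factor `1 + X`) and the other parts are at least `3`. With one part `2` (factor `X ^ 2`),
neither `1` nor `3` can occur, as `1 + 2` and `2 + 3` have the wrong residue, so the other parts are
at least `4`. -/
theorem term5_eq (N : ℤ) (m n : ℕ) : term5 N m n
    = (1 + X) * liftTerm term4 N m n + X ^ 2 * liftTerm (liftTerm term2) N m n := by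
  rw [term5, liftTerm, liftTerm, liftTerm, term4, term2,
    show (N - m - 3 * n - 1 : ℤ) = N - 1 - m - 3 * n by ring,
    show (N - m - 3 * n - 2 : ℤ) = N - 1 - 1 - m - 3 * n by ring,
    show (2 * (N - 1) / 3 - m - n + (if (3 : ℤ) ∣ N - 2 then 1 else 0) : ℤ)
      = 2 * (N - 1 - 1) / 3 - m - n + 1 by
        obtain ⟨k, hk⟩ : ∃ k, N = 3 * k ∨ N = 3 * k + 1 ∨ N = 3 * k + 2 := ⟨N / 3, by omega⟩
        rcases hk with rfl | rfl | rfl <;> split_ifs <;> omega,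
    show (2 * (N - 2) / 3 - m - n : ℤ) = 2 * (N - 1 - 1) / 3 - m - n by
      rw [show N - 1 - 1 = N - 2 by ring]]
  ring

theorem TermRecurrence.congr {r : ℕ} {T U : ℤ → ℕ → ℕ → ℤ[X]} {N : ℕ}
    (h : TermRecurrence r T N) (e : ∀ N m n, T N m n = U N m n) : TermRecurrence r U N := by
  have : T = U := by funext N m n; exact e N m n
  rwa [← this]

theorem termRecurrence_term1 (N : ℕ) : TermRecurrence 2 term1 N :=
  (termRecurrence_genTerm (Or.inl ⟨rfl, rfl⟩)).congr fun N m n => (term1_eq_genTerm N m n).symm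

theorem termRecurrence_term2 {N : ℕ} (hN : 3 ≤ N) : TermRecurrence 2 term2 N :=
  (termRecurrence_genTerm (Or.inr (Or.inl ⟨rfl, rfl, hN⟩))).congr
    fun N m n => (term2_eq_genTerm N m n).symm

theorem termRecurrence_term3 {N : ℕ} (hN : 1 ≤ N) : TermRecurrence 2 term3 N :=
  (termRecurrence_genTerm (Or.inr (Or.inr ⟨rfl, rfl, hN⟩))).congr
    fun N m n => (term3_eq_genTerm N m n).symm

/-- Each part removed on the right accounts for one more factor `X`, which raises `X ^ N`, `X ^ (N -
1)` and `X ^ (N - 2)` to the powers needed at `N + 1`. The hypothesis on `N < 2` keeps the case with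
`N - 2` away from truncated subtraction. -/
theorem TermRecurrence.lift {r : ℕ} {T : ℤ → ℕ → ℕ → ℤ[X]} {N : ℕ} (h : TermRecurrence r T N)
    (hN : N < 2 → r % 3 = 2) : TermRecurrence (r + 1) (liftTerm T) (N + 1) := by
  intro m n
  have h0 := h m n
  have e0 : ((N + 1 : ℕ) : ℤ) - 1 = N := by push_cast; ring
  have e1 : ((N + 1 : ℕ) : ℤ) - 2 = N - 1 := by push_cast; ring
  have e2 : ((N + 1 : ℕ) : ℤ) - 3 = N - 2 := by push_cast; ring
  have e3 : ((N + 1 : ℕ) : ℤ) - 4 = N - 3 := by push_cast; ring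
  have d0 : (N : ℤ) - 1 - 1 = N - 2 := by ring
  have d1 : (N : ℤ) - 2 - 1 = N - 3 := by ring
  have d2 : (N : ℤ) - 3 - 1 = N - 4 := by ring
  unfold topTerms at h0 ⊢
  rw [liftTerm, e0, h0, e1, e2, e3, liftTerm, mul_add]
  congr 1
  have h1 : (N + 1) % 3 = (r + 1) % 3 ↔ N % 3 = r % 3 := by omega
  have h2 : (N + 1) % 3 = (r + 1 + 1) % 3 ↔ N % 3 = (r + 1) % 3 := by omega
  simp only [h1, h2]
  split_ifs with c1 c2
  · obtain ⟨K, rfl⟩ : ∃ K, N = K + 2 := ⟨N - 2, by omega⟩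
    rw [show K + 2 + 1 - 1 = K + 2 by omega, show K + 2 + 1 - 2 = K + 1 by omega,
      show K + 2 - 1 = K + 1 by omega, show K + 2 - 2 = K by omega]
    rcases m with _ | _ | m <;> rcases n with _ | n <;>
      simp only [shiftFst, shiftSnd, liftTerm, d1, d2] <;> ring
  · rcases m with _ | m <;> rcases n with _ | n <;>
      simp only [shiftFst, shiftSnd, liftTerm, d0, d1] <;> ring
  · rcases m with _ | m <;> simp only [shiftFst, liftTerm, d0] <;> ring

/-- The summands vanish outside the range of summation of `doubleSum`. -/
def Bounded (T : ℤ → ℕ → ℕ → ℤ[X]) : Prop :=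
  ∀ (N : ℤ) (m n : ℕ), (N.toNat + 2 ≤ m ∨ N.toNat + 2 ≤ n) → T N m n = 0

theorem doubleSum_eq {T : ℤ → ℕ → ℕ → ℤ[X]} (hT : Bounded T) {N : ℤ} {M : ℕ}
    (h : N.toNat + 2 ≤ M) :
    doubleSum T N = ∑ m ∈ Finset.range M, ∑ n ∈ Finset.range M, T N m n := by
  unfold doubleSum
  have h1 : ∀ m, ∑ n ∈ Finset.range (N.toNat + 2), T N m n = ∑ n ∈ Finset.range M, T N m n := by
    intro m
    refine Finset.sum_subset (Finset.range_mono h) fun n _ hn => hT _ _ _ (Or.inr ?_)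
    simpa using hn
  simp only [h1]
  refine Finset.sum_subset (Finset.range_mono h) fun m _ hm => Finset.sum_eq_zero fun n _ =>
    hT _ _ _ (Or.inl ?_)
  simpa using hm

theorem sum_shiftFst {f : ℕ → ℕ → ℤ[X]} {M : ℕ} (h : ∀ n, f M n = 0) :
    ∑ m ∈ Finset.range (M + 1), ∑ n ∈ Finset.range (M + 1), shiftFst f m n
      = ∑ m ∈ Finset.range (M + 1), ∑ n ∈ Finset.range (M + 1), f m n := by
  rw [Finset.sum_range_succ',
    Finset.sum_range_succ (fun m => ∑ n ∈ Finset.range (M + 1), f m n) M]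
  simp [shiftFst, h]

theorem sum_shiftSnd {f : ℕ → ℕ → ℤ[X]} {M : ℕ} (h : ∀ m, f m M = 0) :
    ∑ m ∈ Finset.range (M + 1), ∑ n ∈ Finset.range (M + 1), shiftSnd f m n
      = ∑ m ∈ Finset.range (M + 1), ∑ n ∈ Finset.range (M + 1), f m n := by
  refine Finset.sum_congr rfl fun m _ => ?_
  rw [Finset.sum_range_succ', Finset.sum_range_succ _ M]
  simp [shiftSnd, h]

theorem TermRecurrence.recurrence {r : ℕ} {T : ℤ → ℕ → ℕ → ℤ[X]} {N : ℕ}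
    (h : TermRecurrence r T N) (hT : Bounded T) : Recurrence r (doubleSum T) N := by
  unfold Recurrence
  -- The range leaves room for two shifts of the first index: the summands for `j ≤ N` vanish from
  -- index `N + 2` on, so a shift loses nothing at the upper end.
  have e : ∀ j : ℤ, j ≤ N → doubleSum T j
      = ∑ m ∈ Finset.range (N + 3 + 1), ∑ n ∈ Finset.range (N + 3 + 1), T j m n :=
    fun j hj => doubleSum_eq hT (by omega)
  have s1 : ∀ j : ℤ, j ≤ N → ∑ m ∈ Finset.range (N + 3 + 1), ∑ n ∈ Finset.range (N + 3 + 1),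
      shiftFst (T j) m n = doubleSum T j := by
    intro j hj
    rw [e j hj, sum_shiftFst fun n => hT _ _ _ (Or.inl (by omega))]
  have s2 : ∀ j : ℤ, j ≤ N → ∑ m ∈ Finset.range (N + 3 + 1), ∑ n ∈ Finset.range (N + 3 + 1),
      shiftSnd (T j) m n = doubleSum T j := by
    intro j hj
    rw [e j hj, sum_shiftSnd fun n => hT _ _ _ (Or.inr (by omega))]
  have s3 : ∀ j : ℤ, j ≤ N → ∑ m ∈ Finset.range (N + 3 + 1), ∑ n ∈ Finset.range (N + 3 + 1),
      shiftFst (shiftFst (T j)) m n = doubleSum T j := by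
    intro j hj
    rw [sum_shiftFst fun n => ?_, s1 j hj]
    exact hT _ _ _ (Or.inl (by omega))
  rw [e N le_rfl]
  have h' : ∀ m n, T N m n = T (N - 1) m n + X ^ N * topTerms r T N m n := h
  simp only [h', Finset.sum_add_distrib, ← Finset.mul_sum]
  rw [← e (N - 1) (by omega)]
  congr 2
  unfold topTerms
  split_ifs with c1 c2
  · simp only [Finset.sum_add_distrib, ← Finset.mul_sum]
    rw [s1 _ (by omega), s2 _ (by omega), s3 _ (by omega)]
    ring
  · simp only [Finset.sum_add_distrib, ← Finset.mul_sum]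
    rw [s1 _ (by omega), s2 _ (by omega)]
  · rw [s1 _ (by omega)]

theorem TermRecurrence.linear {r : ℕ} {T U : ℤ → ℕ → ℕ → ℤ[X]} {N : ℕ}
    (h : TermRecurrence r T N) (h' : TermRecurrence r U N) (c d : ℤ[X]) :
    TermRecurrence r (fun N m n => c * T N m n + d * U N m n) N := by
  intro m n
  have h1 := h m n
  have h2 := h' m n
  simp only [h1, h2]
  unfold topTerms
  split_ifs <;> rcases m with _ | _ | m <;> rcases n with _ | n <;>
    simp only [shiftFst, shiftSnd] <;> ring

theorem termRecurrence_term4 {N : ℕ} (hN : 1 ≤ N) : TermRecurrence 0 term4 N := by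
  obtain ⟨K, rfl⟩ : ∃ K, N = K + 1 := ⟨N - 1, by omega⟩
  have h : TermRecurrence 3 term4 (K + 1) := ((termRecurrence_term1 K).lift fun _ => rfl).congr
    fun N m n => (term4_eq N m n).symm
  exact h

theorem termRecurrence_term5 {N : ℕ} (hN : 5 ≤ N) : TermRecurrence 1 term5 N := by
  obtain ⟨K, rfl⟩ : ∃ K, N = K + 1 + 1 := ⟨N - 2, by omega⟩
  have h1 : TermRecurrence 1 (liftTerm term4) (K + 1 + 1) :=
    (termRecurrence_term4 (by omega)).lift fun _ => by omega
  -- The recurrence for `term2` starts at `3`, and two lifts move this to `5`. The class `4 = 2 + 1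
  -- + 1` is the class `1` modulo `3`.
  have h2 : TermRecurrence 4 (liftTerm (liftTerm term2)) (K + 1 + 1) :=
    ((termRecurrence_term2 (by omega)).lift fun _ => rfl).lift fun _ => by omega
  exact (h1.linear (r := 1) h2 (1 + X) (X ^ 2)).congr fun N m n => (term5_eq N m n).symm

/-! ### Initial values of the double sums -/

theorem KR1_zero : KR1 0 = 1 := by
  simp [KR1, doubleSum, Finset.sum_range_succ, term1, qbin, gaussBinom]

theorem KR1_neg_one : KR1 (-1) = 1 := by
  simp [KR1, doubleSum, Finset.sum_range_succ, term1, qbin, gaussBinom]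

theorem KR1_eq_zero (N : ℤ) (h : N < -1) : KR1 N = 0 := by
  unfold KR1 doubleSum
  refine Finset.sum_eq_zero fun m _ => Finset.sum_eq_zero fun n _ => ?_
  rw [term1, qbin_eq_zero X _ m (by omega)]; simp

theorem KR3_eq_zero (N : ℤ) (h : N < 0) : KR3 N = 0 := by
  unfold KR3 doubleSum
  refine Finset.sum_eq_zero fun m _ => Finset.sum_eq_zero fun n _ => ?_
  rw [term3, qbin_eq_zero (X ^ 3) _ n (by omega)]; simp

theorem KR4_eq_zero (N : ℤ) (h : N < 0) : KR4 N = 0 := by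
  unfold KR4 doubleSum
  refine Finset.sum_eq_zero fun m _ => Finset.sum_eq_zero fun n _ => ?_
  rw [term4, qbin_eq_zero X _ m (by omega)]; simp

theorem KR2_zero : KR2 0 = 1 := by
  simp [KR2, doubleSum, Finset.sum_range_succ, term2, qbin, gaussBinom]

theorem KR2_one : KR2 1 = 1 := by
  simp [KR2, doubleSum, Finset.sum_range_succ, term2, qbin, gaussBinom]

theorem KR2_two : KR2 2 = 1 + X ^ 2 := by
  simp [KR2, doubleSum, Finset.sum_range_succ, term2, qbin, gaussBinom]

theorem KR3_zero : KR3 0 = 1 := by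
  simp [KR3, doubleSum, Finset.sum_range_succ, term3, qbin, qbinStar, gaussBinom]

theorem KR4_zero : KR4 0 = 1 := by
  simp [KR4, doubleSum, Finset.sum_range_succ, term4, qbin, gaussBinom]

theorem KR5_one : KR5 1 = 1 + X := by
  simp [KR5, doubleSum, Finset.sum_range_succ, term5, qbin, gaussBinom]

theorem KR5_two : KR5 2 = 1 + X + X ^ 2 := by
  simp [KR5, doubleSum, Finset.sum_range_succ, term5, qbin, gaussBinom]

theorem KR5_three : KR5 3 = 1 + X + X ^ 2 + X ^ 3 + X ^ 4 := by
  simp [KR5, doubleSum, Finset.sum_range_succ, term5, qbin, gaussBinom]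
  ring

theorem KR5_four : KR5 4
    = 1 + X + X ^ 2 + X ^ 3 + 2 * X ^ 4 + X ^ 5 + X ^ 6 + X ^ 7 + X ^ 8 := by
  simp [KR5, doubleSum, Finset.sum_range_succ, term5, qbin, gaussBinom]
  ring

/-! ### Admissible lists -/

/-- The gap condition for a list of parts in non-increasing order. -/
def Good (r : ℕ) : List ℕ → Prop
  | a :: b :: l => b ≤ a ∧ (a ≤ b + 1 → (a + b) % 3 = r % 3) ∧ (∀ c ∈ l.head?, c + 3 ≤ a)
      ∧ Good r (b :: l)
  | _ => True

instance decidableGood (r : ℕ) : ∀ l, Decidable (Good r l)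
  | [] => isTrue trivial
  | [_] => isTrue trivial
  | a :: b :: l =>
    have := decidableGood r (b :: l)
    inferInstanceAs (Decidable (b ≤ a ∧ (a ≤ b + 1 → (a + b) % 3 = r % 3)
      ∧ (∀ c ∈ l.head?, c + 3 ≤ a) ∧ Good r (b :: l)))

@[simp] theorem good_nil (r : ℕ) : Good r [] := trivial

@[simp] theorem good_singleton (r a : ℕ) : Good r [a] := trivial

@[simp] theorem good_pair (r a b : ℕ) :
    Good r [a, b] ↔ b ≤ a ∧ (a ≤ b + 1 → (a + b) % 3 = r % 3) := by
  simp [Good]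

theorem good_cons_cons (r a b c : ℕ) (l : List ℕ) :
    Good r (a :: b :: c :: l) ↔ b ≤ a ∧ (a ≤ b + 1 → (a + b) % 3 = r % 3) ∧ c + 3 ≤ a
      ∧ Good r (b :: c :: l) := by
  rw [Good]; simp

theorem Good.tail {r a : ℕ} {l : List ℕ} (h : Good r (a :: l)) : Good r l := by
  cases l with
  | nil => trivial
  | cons b l => exact h.2.2.2

theorem Good.le_head {r : ℕ} : ∀ {l : List ℕ} {a : ℕ}, Good r (a :: l) → ∀ x ∈ l, x ≤ a
  | [], _, _, x, hx => by simp at hx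
  | b :: l, a, h, x, hx => by
    rcases List.mem_cons.1 hx with rfl | hx
    · exact h.1
    · exact (Good.le_head h.2.2.2 x hx).trans h.1

/-- The lists of parts in non-increasing order, at least `L` and at most `N`, that satisfy the gap
condition. -/
def adm (r L : ℕ) : ℕ → Finset (List ℕ)
  | 0 => {[]}
  | N + 1 => adm r L N ∪ ((adm r L N).image (fun l => (N + 1) :: l)
      ∪ (adm r L N).image (fun l => (N + 1) :: (N + 1) :: l)).filter
        (fun l => Good r l ∧ ∀ x ∈ l, L ≤ x)

theorem mem_adm {r L : ℕ} (hL : 1 ≤ L) {N : ℕ} {l : List ℕ} :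
    l ∈ adm r L N ↔ Good r l ∧ ∀ x ∈ l, L ≤ x ∧ x ≤ N := by
  induction N generalizing l with
  | zero =>
    rw [adm, Finset.mem_singleton]
    constructor
    · rintro rfl; simp
    · rintro ⟨-, h⟩
      exact List.eq_nil_iff_forall_not_mem.2 fun x hx => by have := h x hx; omega
  | succ N ih =>
    rw [adm, Finset.mem_union, Finset.mem_filter, Finset.mem_union, Finset.mem_image,
      Finset.mem_image]
    constructor
    · rintro (h | ⟨⟨t, ht, rfl⟩ | ⟨t, ht, rfl⟩, h1, h2⟩)
      · exact ⟨(ih.1 h).1, fun x hx => by have := (ih.1 h).2 x hx; omega⟩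
      · refine ⟨h1, fun x hx => ⟨h2 x hx, ?_⟩⟩
        rcases List.mem_cons.1 hx with rfl | hx
        · exact le_rfl
        · exact h1.le_head x hx
      · refine ⟨h1, fun x hx => ⟨h2 x hx, ?_⟩⟩
        rcases List.mem_cons.1 hx with rfl | hx
        · exact le_rfl
        · exact h1.le_head x hx
    · rintro ⟨h1, h2⟩
      have key : ∀ t : List ℕ, Good r t → (∀ x ∈ t, L ≤ x ∧ x ≤ N + 1) → t.head? ≠ some (N + 1) →
          t ∈ adm r L N := by
        intro t ht h3 h4
        refine ih.2 ⟨ht, fun x hx => ⟨(h3 x hx).1, ?_⟩⟩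
        cases t with
        | nil => simp at hx
        | cons b t =>
          have hb := (h3 b (by simp)).2
          have hb' : b ≠ N + 1 := by simpa using h4
          rcases List.mem_cons.1 hx with rfl | hx
          · omega
          · have := ht.le_head x hx
            omega
      by_cases c1 : l.head? = some (N + 1)
      · right
        refine ⟨?_, h1, fun x hx => (h2 x hx).1⟩
        rcases l with _ | ⟨a, t⟩
        · simp at c1
        obtain rfl : a = N + 1 := by simpa using c1
        by_cases c2 : t.head? = some (N + 1)
        · right
          rcases t with _ | ⟨b, t⟩
          · simp at c2
          obtain rfl : b = N + 1 := by simpa using c2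
          refine ⟨t, key t h1.tail.tail (fun x hx => h2 x (by simp [hx])) fun h => ?_, rfl⟩
          have := h1.2.2.1 _ h
          omega
        · exact Or.inl ⟨t, key t h1.tail (fun x hx => h2 x (by simp [hx])) c2, rfl⟩
      · exact Or.inl (key l h1 h2 c1)

theorem nil_mem_adm {r L : ℕ} (hL : 1 ≤ L) (N : ℕ) : [] ∈ adm r L N :=
  (mem_adm hL).2 (by simp)

theorem cons_mem_adm {r L : ℕ} (hL : 1 ≤ L) {N a : ℕ} {l : List ℕ} :
    a :: l ∈ adm r L N ↔ Good r (a :: l) ∧ a ≤ N ∧ L ≤ a ∧ ∀ x ∈ l, L ≤ x := by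
  rw [mem_adm hL]
  refine and_congr_right fun h => ⟨fun h1 => ⟨(h1 a (by simp)).2, (h1 a (by simp)).1,
    fun x hx => (h1 x (by simp [hx])).1⟩, fun h1 x hx => ?_⟩
  rcases List.mem_cons.1 hx with rfl | hx
  · exact ⟨h1.2.1, h1.1⟩
  · exact ⟨h1.2.2 x hx, (h.le_head x hx).trans h1.1⟩

theorem sum_union_image_cons {s u : Finset (List ℕ)} {a : ℕ} (h : ∀ t ∈ s, a ∉ t)
    (f : List ℕ → ℤ[X]) :
    ∑ l ∈ s ∪ u.image (fun t => a :: t), f l = ∑ l ∈ s, f l + ∑ t ∈ u, f (a :: t) := by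
  rw [Finset.sum_union, Finset.sum_image]
  · intro x _ y _ hxy
    simpa using hxy
  · rw [Finset.disjoint_left]
    rintro l hl hl'
    obtain ⟨t, -, rfl⟩ := Finset.mem_image.1 hl'
    exact h _ hl (by simp)

theorem not_mem_of_mem_adm {r L : ℕ} (hL : 1 ≤ L) {N a : ℕ} (ha : N < a) :
    ∀ t ∈ adm r L N, a ∉ t := fun t ht hat => by
  have := ((mem_adm hL).1 ht).2 a hat
  omega

theorem sum_adm_eq {r L : ℕ} (hL : 1 ≤ L) {N : ℕ} (hN : 1 ≤ N) {s : Finset (List ℕ)}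
    (hs : ∀ t, t ∈ s ↔ N :: t ∈ adm r L N) (f : List ℕ → ℤ[X]) :
    ∑ l ∈ adm r L N, f l = ∑ l ∈ adm r L (N - 1), f l + ∑ t ∈ s, f (N :: t) := by
  rw [← sum_union_image_cons (not_mem_of_mem_adm hL (by omega))]
  congr 1
  ext l
  rw [Finset.mem_union, Finset.mem_image]
  constructor
  · intro h
    cases l with
    | nil => exact Or.inl (nil_mem_adm hL _)
    | cons a t =>
      by_cases ha : a = N
      · subst ha
        exact Or.inr ⟨t, (hs t).2 h, rfl⟩
      · left
        rw [cons_mem_adm hL] at h ⊢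
        exact ⟨h.1, by omega, h.2.2⟩
  · rintro (h | ⟨t, ht, rfl⟩)
    · rw [mem_adm hL] at h ⊢
      exact ⟨h.1, fun x hx => by have := h.2 x hx; omega⟩
    · exact (hs t).1 ht

/-- In this class neither `N + N` nor `N + (N - 1)` is congruent to `r`, so the next part is at most
`N - 2`. Since `{N - 2, N - 2}` is not a pair either, the distance-two condition then holds by
itself. -/
theorem tail_mem_two {r L N : ℕ} (hL : 1 ≤ L) (hr : r < 3) (hN : L + 2 ≤ N)
    (h : N % 3 = (2 * r + 1) % 3) (t : List ℕ) :
    t ∈ adm r L (N - 2) ↔ N :: t ∈ adm r L N := by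
  rcases t with _ | ⟨b, _ | ⟨c, t⟩⟩
  · simp only [nil_mem_adm hL, cons_mem_adm hL, true_iff]
    refine ⟨trivial, le_rfl, by omega, by simp⟩
  · simp only [cons_mem_adm hL, List.forall_mem_cons, good_pair, good_singleton]
    constructor <;> rintro ⟨h1, h2, h3⟩ <;> grind
  · simp only [cons_mem_adm hL, List.forall_mem_cons, good_cons_cons]
    constructor
    · rintro ⟨h1, h2⟩
      have h3 := h1.1
      have h4 := h1.2.1
      refine ⟨⟨by omega, by omega, ?_, h1⟩, le_rfl, by omega, h2.2⟩
      interval_cases r <;> omega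
    · rintro ⟨⟨h1, h2, h3, h4⟩, -, h5, h6⟩
      exact ⟨h4, by omega, h6⟩

theorem cons_mem_union {s u : Finset (List ℕ)} {a b : ℕ} {t : List ℕ} :
    b :: t ∈ s ∪ u.image (fun t => a :: t) ↔ b :: t ∈ s ∨ (b = a ∧ t ∈ u) := by
  rw [Finset.mem_union, Finset.mem_image]
  refine or_congr_right ⟨?_, ?_⟩
  · rintro ⟨t', h, e⟩
    rw [List.cons.injEq] at e
    exact ⟨e.1.symm, e.2 ▸ h⟩
  · rintro ⟨rfl, h⟩
    exact ⟨t, h, rfl⟩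

theorem nil_mem_union {s u : Finset (List ℕ)} {a : ℕ} (h : [] ∈ s) :
    [] ∈ s ∪ u.image (fun t => a :: t) := Finset.mem_union_left _ h

/-- Here `2N ≡ r`, so `N` may be repeated, and after `N, N` the parts are at most `N - 3`. The pair
`{N - 1, N}` is excluded. After a single `N` any admissible list up to `N - 2` may follow, because
`N - 2` cannot be repeated. -/
theorem tail_mem_one {r L N : ℕ} (hL : 1 ≤ L) (hr : r < 3) (hN : L + 2 ≤ N)
    (h : N % 3 = (2 * r) % 3) (t : List ℕ) :
    t ∈ adm r L (N - 2) ∪ (adm r L (N - 3)).image (fun t => N :: t) ↔ N :: t ∈ adm r L N := by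
  rcases t with _ | ⟨b, _ | ⟨c, _ | ⟨d, t⟩⟩⟩
  · simp only [nil_mem_union (nil_mem_adm hL _), cons_mem_adm hL, true_iff]
    refine ⟨trivial, le_rfl, by omega, by simp⟩
  · simp only [cons_mem_union, nil_mem_adm hL, cons_mem_adm hL, List.forall_mem_cons, good_pair,
      good_singleton, List.not_mem_nil, false_imp_iff, implies_true, and_true, true_and]
    interval_cases r <;> omega
  · simp only [cons_mem_union, cons_mem_adm hL, List.forall_mem_cons, good_pair, good_cons_cons,
      good_singleton, List.not_mem_nil, false_imp_iff, implies_true, and_true, true_and]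
    interval_cases r <;> omega
  · simp only [cons_mem_union, cons_mem_adm hL, List.forall_mem_cons, good_cons_cons]
    by_cases hg : Good r (c :: d :: t)
    · have h1 := hg.1
      have h2 := hg.2.1
      simp only [hg, and_true]
      by_cases ht : ∀ x ∈ t, L ≤ x
      · simp only [eq_true ht, and_true, true_and]
        interval_cases r <;> omega
      · simp [ht]
    · simp [hg]

/-- Here `2N - 1 ≡ r`, so `{N - 1, N}` is allowed and `{N, N}` is not. Now `{N - 2, N - 2}`
satisfies the residue condition but is too close to `N`, so a next part `N - 2` is treated
separately. As `{N - 3, N - 2}` has the wrong residue, it is followed by parts at most `N - 4`. -/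
theorem tail_mem_zero {r L N : ℕ} (hL : 1 ≤ L) (hr : r < 3) (hN : L + 2 ≤ N)
    (h : N % 3 = (2 * r + 2) % 3) (t : List ℕ) :
    t ∈ (adm r L (N - 3) ∪ (adm r L (N - 4)).image (fun t => (N - 2) :: t))
        ∪ (adm r L (N - 3)).image (fun t => (N - 1) :: t) ↔ N :: t ∈ adm r L N := by
  rcases t with _ | ⟨b, _ | ⟨c, _ | ⟨d, t⟩⟩⟩
  · simp only [nil_mem_union (nil_mem_union (nil_mem_adm hL _)), cons_mem_adm hL, true_iff]
    refine ⟨trivial, le_rfl, by omega, by simp⟩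
  · simp only [cons_mem_union, nil_mem_adm hL, cons_mem_adm hL, List.forall_mem_cons, good_pair,
      good_singleton, List.not_mem_nil, false_imp_iff, implies_true, and_true, true_and]
    interval_cases r <;> omega
  · simp only [cons_mem_union, cons_mem_adm hL, List.forall_mem_cons, good_pair, good_cons_cons,
      good_singleton, List.not_mem_nil, false_imp_iff, implies_true, and_true, true_and]
    interval_cases r <;> omega
  · simp only [cons_mem_union, cons_mem_adm hL, List.forall_mem_cons, good_cons_cons]
    by_cases hg : Good r (c :: d :: t)
    · have h1 := hg.1
      have h2 := hg.2.1
      simp only [hg, and_true]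
      by_cases ht : ∀ x ∈ t, L ≤ x
      · simp only [eq_true ht, and_true, true_and]
        interval_cases r <;> omega
      · simp [ht]
    · simp [hg]

/-- The contribution of the lists with largest part `N` to a sum over `adm r L N`. -/
noncomputable def topSum (r L N : ℕ) (f : List ℕ → ℤ[X]) : ℤ[X] :=
  if N % 3 = (2 * r + 2) % 3 then
    ∑ t ∈ adm r L (N - 3), f (N :: t) + ∑ t ∈ adm r L (N - 3), f (N :: (N - 1) :: t)
      + ∑ t ∈ adm r L (N - 4), f (N :: (N - 2) :: t)
  else if N % 3 = (2 * r + 2 + 1) % 3 then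
    ∑ t ∈ adm r L (N - 2), f (N :: t) + ∑ t ∈ adm r L (N - 3), f (N :: N :: t)
  else ∑ t ∈ adm r L (N - 2), f (N :: t)

theorem sum_adm {r L N : ℕ} (hL : 1 ≤ L) (hr : r < 3) (hN : L + 2 ≤ N) (f : List ℕ → ℤ[X]) :
    ∑ l ∈ adm r L N, f l = ∑ l ∈ adm r L (N - 1), f l + topSum r L N f := by
  unfold topSum
  split_ifs with h1 h2
  · rw [sum_adm_eq hL (by omega) (tail_mem_zero hL hr hN h1), sum_union_image_cons,
      sum_union_image_cons, add_right_comm (∑ t ∈ _, _)]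
    · exact not_mem_of_mem_adm hL (by omega)
    · intro t ht hmem
      rcases Finset.mem_union.1 ht with ht | ht
      · exact not_mem_of_mem_adm hL (by omega) t ht hmem
      · obtain ⟨t', ht', rfl⟩ := Finset.mem_image.1 ht
        rcases List.mem_cons.1 hmem with h | h
        · omega
        · exact not_mem_of_mem_adm hL (by omega) t' ht' h
  · rw [sum_adm_eq hL (by omega) (tail_mem_one hL hr hN (by omega)), sum_union_image_cons]
    exact not_mem_of_mem_adm hL (by omega)
  · rw [sum_adm_eq hL (by omega) (tail_mem_two hL hr hN (by interval_cases r <;> omega))]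

/-- The number of pairs of consecutive parts that differ by at most `1`. -/
def numClose : List ℕ → ℕ
  | a :: b :: l => (if a ≤ b + 1 then 1 else 0) + numClose (b :: l)
  | _ => 0

theorem numClose_cons_of_lt {a : ℕ} {l : List ℕ} (h : ∀ b ∈ l.head?, b + 1 < a) :
    numClose (a :: l) = numClose l := by
  cases l with
  | nil => rfl
  | cons b l =>
    have := h b rfl
    rw [numClose, if_neg (by omega), zero_add]

/-- Pairs are disjoint: two pairs sharing a part would give parts at distance two that differ by at
most `2`. -/
theorem Good.two_mul_numClose_le {r : ℕ} : ∀ {l : List ℕ}, Good r l → 2 * numClose l ≤ l.length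
  | [], _ => by simp [numClose]
  | [a], _ => by simp [numClose]
  | [a, b], _ => by
    simp only [numClose, List.length_cons, List.length_nil]
    split_ifs <;> omega
  | a :: b :: c :: l, h => by
    rw [good_cons_cons] at h
    have h1 := Good.two_mul_numClose_le h.2.2.2
    have h2 := Good.two_mul_numClose_le h.2.2.2.tail
    by_cases hab : a ≤ b + 1
    -- From `c + 3 ≤ a ≤ b + 1` it follows that `b` and `c` do not form a pair.
    · rw [numClose, if_pos hab, numClose, if_neg (by omega)]
      simp only [List.length_cons] at *
      omega
    · rw [numClose, if_neg hab]
      simp only [List.length_cons] at *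
      omega

/-- The monomial of a list that has exactly `n` pairs and `m` singletons. -/
noncomputable def typeWeight (l : List ℕ) (m n : ℕ) : ℤ[X] :=
  if numClose l = n ∧ l.length = m + 2 * n then X ^ l.sum else 0

/-- The new largest part is a singleton. The bound on `numClose` is needed for `m = 0`: a list with
a singleton must not have a type with none. -/
theorem typeWeight_cons {a : ℕ} {l : List ℕ} (h : ∀ b ∈ l.head?, b + 1 < a)
    (hl : 2 * numClose l ≤ l.length) (m n : ℕ) :
    typeWeight (a :: l) m n = X ^ a * shiftFst (typeWeight l) m n := by
  cases m with
  | zero =>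
    rw [shiftFst, mul_zero, typeWeight, numClose_cons_of_lt h, if_neg]
    rw [List.length_cons]
    omega
  | succ m =>
    rw [shiftFst, typeWeight, typeWeight, numClose_cons_of_lt h, List.length_cons, List.sum_cons,
      pow_add, mul_ite, mul_zero]
    refine if_congr ?_ rfl rfl
    omega

theorem typeWeight_cons_cons {a b : ℕ} {l : List ℕ} (hab : a ≤ b + 1)
    (h : ∀ c ∈ l.head?, c + 1 < b) (m n : ℕ) :
    typeWeight (a :: b :: l) m n = X ^ (a + b) * shiftSnd (typeWeight l) m n := by
  have e : numClose (a :: b :: l) = 1 + numClose l := by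
    rw [numClose, if_pos hab, numClose_cons_of_lt h]
  cases n with
  | zero =>
    rw [shiftSnd, mul_zero, typeWeight, e, if_neg]
    omega
  | succ n =>
    rw [shiftSnd, typeWeight, typeWeight, e, List.length_cons, List.length_cons, List.sum_cons,
      List.sum_cons, ← add_assoc, pow_add, mul_ite, mul_zero]
    refine if_congr ?_ rfl rfl
    omega

/-- The generating function of the lists in `adm r L N` that have exactly `n` pairs and `m`
singletons. -/
noncomputable def typeSum (r L N : ℕ) (m n : ℕ) : ℤ[X] :=
  ∑ l ∈ adm r L N, typeWeight l m n

theorem shiftFst_sum (s : Finset (List ℕ)) (f : List ℕ → ℕ → ℕ → ℤ[X]) (m n : ℕ) :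
    ∑ l ∈ s, shiftFst (f l) m n = shiftFst (fun m n => ∑ l ∈ s, f l m n) m n := by
  cases m <;> simp [shiftFst]

theorem shiftSnd_sum (s : Finset (List ℕ)) (f : List ℕ → ℕ → ℕ → ℤ[X]) (m n : ℕ) :
    ∑ l ∈ s, shiftSnd (f l) m n = shiftSnd (fun m n => ∑ l ∈ s, f l m n) m n := by
  cases n <;> simp [shiftSnd]

theorem head_le_of_mem_adm {r L N : ℕ} (hL : 1 ≤ L) {l : List ℕ} (h : l ∈ adm r L N) :
    ∀ b ∈ l.head?, b ≤ N := fun b hb =>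
  (((mem_adm hL).1 h).2 b (List.mem_of_mem_head? hb)).2

/-- A new singleton shifts `m`, a new pair shifts `n`, and the two singletons `N, N - 2` shift `m`
twice. The bounds on the tails ensure that no further pair arises where the new parts meet the tail.
-/
theorem topSum_typeWeight {r L N : ℕ} (hL : 1 ≤ L) (hN : L + 2 ≤ N)
    (hN' : 4 ≤ N ∨ N % 3 ≠ (2 * r + 2) % 3) (m n : ℕ) :
    topSum r L N (fun l => typeWeight l m n)
      = X ^ N * topTerms (2 * r + 2) (fun N => typeSum r L N.toNat) N m n := by
  have f1 : ∀ a M, M + 2 ≤ a → ∑ t ∈ adm r L M, typeWeight (a :: t) m n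
      = X ^ a * shiftFst (typeSum r L M) m n := by
    intro a M ha
    have : ∀ t ∈ adm r L M, typeWeight (a :: t) m n = X ^ a * shiftFst (typeWeight t) m n :=
      fun t ht => typeWeight_cons (fun b hb => by have := head_le_of_mem_adm hL ht b hb; omega)
        ((mem_adm hL).1 ht).1.two_mul_numClose_le _ _
    rw [Finset.sum_congr rfl this, ← Finset.mul_sum, shiftFst_sum]
    rfl
  have f2 : ∀ a b M, M + 2 ≤ b → a ≤ b + 1 → ∑ t ∈ adm r L M, typeWeight (a :: b :: t) m n
      = X ^ (a + b) * shiftSnd (typeSum r L M) m n := by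
    intro a b M hb ha
    have : ∀ t ∈ adm r L M,
        typeWeight (a :: b :: t) m n = X ^ (a + b) * shiftSnd (typeWeight t) m n :=
      fun t ht => typeWeight_cons_cons ha
        (fun b hb => by have := head_le_of_mem_adm hL ht b hb; omega) _ _
    rw [Finset.sum_congr rfl this, ← Finset.mul_sum, shiftSnd_sum]
    rfl
  have f3 : ∀ a b M, M + 2 ≤ b → b + 2 ≤ a → ∑ t ∈ adm r L M, typeWeight (a :: b :: t) m n
      = X ^ (a + b) * shiftFst (shiftFst (typeSum r L M)) m n := by
    intro a b M hb ha
    have : ∀ t ∈ adm r L M,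
        typeWeight (a :: b :: t) m n = X ^ (a + b) * shiftFst (shiftFst (typeWeight t)) m n := by
      intro t ht
      have h1 : ∀ c ∈ t.head?, c + 1 < b := fun c hc => by
        have := head_le_of_mem_adm hL ht c hc
        omega
      have h2 := ((mem_adm hL).1 ht).1.two_mul_numClose_le
      rw [typeWeight_cons (by simp; omega) (by
        rw [numClose_cons_of_lt h1, List.length_cons]; omega)]
      rcases m with _ | m
      · simp [shiftFst]
      · rw [shiftFst, typeWeight_cons h1 h2, ← mul_assoc, ← pow_add]
        rfl
    rw [Finset.sum_congr rfl this, ← Finset.mul_sum, shiftFst_sum]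
    congr 2
    funext m n
    rw [shiftFst_sum]
    rfl
  have e2 : ((N : ℤ) - 2).toNat = N - 2 := by omega
  have e3 : ((N : ℤ) - 3).toNat = N - 3 := by omega
  have e4 : ((N : ℤ) - 4).toNat = N - 4 := by omega
  unfold topSum topTerms
  simp only [e2, e3, e4]
  split_ifs with c1 c2
  · rw [f1 _ _ (by omega), f2 _ _ _ (by omega) (by omega), f3 _ _ _ (by omega) (by omega), pow_add,
      pow_add]
    ring
  · rw [f1 _ _ (by omega), f2 _ _ _ (by omega) (by omega), pow_add]
    ring
  · rw [f1 _ _ (by omega)]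

theorem topTerms_congr {r : ℕ} {T U : ℤ → ℕ → ℕ → ℤ[X]} {N : ℕ} (h3 : 3 ≤ N)
    (h4 : 4 ≤ N ∨ N % 3 ≠ r % 3) (h : ∀ j : ℤ, 0 ≤ j → j < N → T j = U j) :
    topTerms r T N = topTerms r U N := by
  funext m n
  unfold topTerms
  rw [h (N - 2) (by omega) (by omega), h (N - 3) (by omega) (by omega)]
  split_ifs
  · rw [h (N - 4) (by omega) (by omega)]
  · rfl
  · rfl

theorem TermRecurrence.of_mod {r s : ℕ} {T : ℤ → ℕ → ℕ → ℤ[X]} {N : ℕ}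
    (h : TermRecurrence r T N) (hrs : r % 3 = s % 3) : TermRecurrence s T N := by
  have : topTerms s T N = topTerms r T N := by
    funext m n
    unfold topTerms
    rw [hrs, Nat.add_mod r, hrs, ← Nat.add_mod]
  intro m n
  rw [this]
  exact h m n

/-- A solution of the recurrence is determined by its initial values. -/
theorem eq_typeSum {r L : ℕ} (hL : 1 ≤ L) (hr : r < 3) (hrL : L = 1 → r ≠ 2) {T : ℤ → ℕ → ℕ → ℤ[X]}
    {ρ : ℕ} (hρ : (2 * r + 2) % 3 = ρ % 3) (hT : ∀ N : ℕ, L + 2 ≤ N → TermRecurrence ρ T N)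
    (h0 : ∀ N : ℕ, N < L + 2 → ∀ m n, T N m n = typeSum r L N m n) (N : ℕ) (m n : ℕ) :
    T N m n = typeSum r L N m n := by
  induction N using Nat.strong_induction_on generalizing m n with
  | _ N ih =>
    rcases Nat.lt_or_ge N (L + 2) with hN | hN
    · exact h0 N hN m n
    · have h1 := sum_adm hL hr hN (fun l => typeWeight l m n)
      -- The induction hypothesis covers only nonnegative arguments. The argument `N - 4` could be
      -- negative only for `N = 3`, `L = 1`, and then it occurs only if `r = 2`, which `hrL`
      -- excludes.
      have hN' : 4 ≤ N ∨ N % 3 ≠ (2 * r + 2) % 3 := by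
        rcases Nat.lt_or_ge N 4 with h4 | h4
        · have h3 : N = 3 := by omega
          subst h3
          have := hrL (by omega)
          omega
        · exact Or.inl h4
      rw [topSum_typeWeight hL hN hN'] at h1
      rw [typeSum, h1, (hT N hN).of_mod hρ.symm]
      have ih' : ∀ j : ℤ, 0 ≤ j → j < N → T j = typeSum r L j.toNat := by
        intro j hj hj'
        have := ih j.toNat (by omega)
        rw [Int.toNat_of_nonneg hj] at this
        funext m n
        exact this m n
      have e1 : ((N : ℤ) - 1).toNat = N - 1 := by omega
      rw [ih' (N - 1) (by omega) (by omega), e1, ← typeSum]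
      rw [topTerms_congr (by omega) hN' ih']

/-! ### Initial values for the comparison -/

theorem adm_zero (r L : ℕ) : adm r L 0 = {[]} := rfl
theorem adm_0_1_1 : adm 0 1 1 = {[], [1]} := by decide
theorem adm_0_1_2 : adm 0 1 2 = {[], [1], [2], [2, 1]} := by decide
theorem adm_0_2_1 : adm 0 2 1 = {[]} := by decide
theorem adm_0_2_2 : adm 0 2 2 = {[], [2]} := by decide
theorem adm_0_2_3 : adm 0 2 3 = {[], [2], [3], [3, 3]} := by decide
theorem adm_0_3_1 : adm 0 3 1 = {[]} := by decide
theorem adm_0_3_2 : adm 0 3 2 = {[]} := by decide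
theorem adm_0_3_3 : adm 0 3 3 = {[], [3], [3, 3]} := by decide
theorem adm_0_3_4 : adm 0 3 4 = {[], [3], [4], [3, 3]} := by decide
theorem adm_2_2_1 : adm 2 2 1 = {[]} := by decide
theorem adm_2_2_2 : adm 2 2 2 = {[], [2]} := by decide
theorem adm_2_2_3 : adm 2 2 3 = {[], [2], [3], [3, 2]} := by decide
theorem adm_1_1_1 : adm 1 1 1 = {[], [1]} := by decide
theorem adm_1_1_2 : adm 1 1 2 = {[], [1], [2], [2, 2]} := by decide
theorem adm_1_1_3 : adm 1 1 3 = {[], [1], [2], [2, 2], [3], [3, 1]} := by decide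
theorem adm_1_1_4 : adm 1 1 4 = {[], [1], [2], [2, 2], [3], [3, 1], [4], [4, 1], [4, 2], [4, 3],
    [4, 3, 1]} := by decide

/-- To compare with `typeSum` when all the lists have at most two parts, it suffices to do so for
at most two singletons and at most one pair. -/
theorem typeSum_eq_of_length_le {r L N : ℕ} {f : ℕ → ℕ → ℤ[X]}
    (hl : ∀ l ∈ adm r L N, l.length ≤ 2) (h0 : ∀ m n, 3 ≤ m ∨ 2 ≤ n → f m n = 0)
    (h : ∀ m < 3, ∀ n < 2, f m n = typeSum r L N m n) (m n : ℕ) : f m n = typeSum r L N m n := by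
  by_cases hmn : m < 3 ∧ n < 2
  · exact h m hmn.1 n hmn.2
  · rw [h0 m n (by omega), typeSum, Finset.sum_eq_zero]
    intro l hl'
    have := hl l hl'
    rw [typeWeight, if_neg (by omega)]

theorem genTerm_eq_zero_of {α δ : ℕ} {N : ℤ} {m n : ℕ}
    (h : (N - m - 3 * n + 1 - α < m ∧ ¬(N - m - 3 * n + 1 - α = -1 ∧ m = 0))
      ∨ 2 * N / 3 - m - n + 1 - δ < n) : genTerm α δ N m n = 0 := by
  rw [genTerm, qbinStar_mul_qbin_eq_zero h, mul_zero]

theorem term1_initial (N : ℕ) (hN : N < 3) (m n : ℕ) : term1 N m n = typeSum 0 1 N m n := by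
  refine typeSum_eq_of_length_le ?_ (fun m n h => ?_) ?_ m n
  · interval_cases N <;> decide
  · rw [term1_eq_genTerm, genTerm_eq_zero_of]; omega
  · intro m hm n hn
    interval_cases N <;> interval_cases m <;> interval_cases n <;>
      simp [typeSum, adm_zero, adm_0_1_1, adm_0_1_2, typeWeight, numClose, term1, qbin, gaussBinom]
    ring

theorem term2_initial (N : ℕ) (hN : N < 4) (m n : ℕ) : term2 N m n = typeSum 0 2 N m n := by
  refine typeSum_eq_of_length_le ?_ (fun m n h => ?_) ?_ m n
  · interval_cases N <;> decide
  · rw [term2_eq_genTerm, genTerm_eq_zero_of]; omega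
  · intro m hm n hn
    interval_cases N <;> interval_cases m <;> interval_cases n <;>
      simp [typeSum, adm_zero, adm_0_2_1, adm_0_2_2, adm_0_2_3, typeWeight, numClose, term2, qbin,
        gaussBinom]
    ring

theorem term3_initial (N : ℕ) (hN : N < 5) (m n : ℕ) : term3 N m n = typeSum 0 3 N m n := by
  refine typeSum_eq_of_length_le ?_ (fun m n h => ?_) ?_ m n
  · interval_cases N <;> decide
  · rw [term3_eq_genTerm, genTerm_eq_zero_of]; omega
  · intro m hm n hn
    interval_cases N <;> interval_cases m <;> interval_cases n <;>
      simp [typeSum, adm_zero, adm_0_3_1, adm_0_3_2, adm_0_3_3, adm_0_3_4, typeWeight, numClose,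
        term3, qbin, qbinStar, gaussBinom]
    ring

theorem term4_initial (N : ℕ) (hN : N < 4) (m n : ℕ) : term4 N m n = typeSum 2 2 N m n := by
  refine typeSum_eq_of_length_le ?_ (fun m n h => ?_) ?_ m n
  · interval_cases N <;> decide
  · rw [term4_eq, liftTerm, term1_eq_genTerm, genTerm_eq_zero_of, mul_zero]; omega
  · intro m hm n hn
    interval_cases N <;> interval_cases m <;> interval_cases n <;>
      simp [typeSum, adm_zero, adm_2_2_1, adm_2_2_2, adm_2_2_3, typeWeight, numClose, term4, qbin,
        gaussBinom]
    ring

theorem term1_eq_typeSum (N m n : ℕ) : term1 N m n = typeSum 0 1 N m n :=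
  eq_typeSum (T := term1) (ρ := 2) (by norm_num) (by norm_num) (by norm_num) rfl
    (fun N _ => termRecurrence_term1 N) (fun N hN => term1_initial N (by omega)) N m n

theorem term2_eq_typeSum (N m n : ℕ) : term2 N m n = typeSum 0 2 N m n :=
  eq_typeSum (T := term2) (ρ := 2) (by norm_num) (by norm_num) (by norm_num) rfl
    (fun N hN => termRecurrence_term2 (by omega)) (fun N hN => term2_initial N (by omega)) N m n

theorem term3_eq_typeSum (N m n : ℕ) : term3 N m n = typeSum 0 3 N m n :=
  eq_typeSum (T := term3) (ρ := 2) (by norm_num) (by norm_num) (by norm_num) rfl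
    (fun N hN => termRecurrence_term3 (by omega)) (fun N hN => term3_initial N (by omega)) N m n

theorem term4_eq_typeSum (N m n : ℕ) : term4 N m n = typeSum 2 2 N m n :=
  eq_typeSum (T := term4) (ρ := 0) (by norm_num) (by norm_num) (by norm_num) rfl
    (fun N hN => termRecurrence_term4 (by omega)) (fun N hN => term4_initial N (by omega)) N m n

/-- Each list has exactly one type, with `n = numClose l` and `m = l.length - 2 * numClose l`; the
subtraction is exact because pairs are disjoint. -/
theorem sum_typeSum {r L N M : ℕ} (hL : 1 ≤ L) (hM : ∀ l ∈ adm r L N, l.length < M) :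
    ∑ m ∈ Finset.range M, ∑ n ∈ Finset.range M, typeSum r L N m n
      = ∑ l ∈ adm r L N, (X ^ l.sum : ℤ[X]) := by
  have h : ∀ m, ∑ n ∈ Finset.range M, typeSum r L N m n
      = ∑ l ∈ adm r L N, ∑ n ∈ Finset.range M, typeWeight l m n := fun m => Finset.sum_comm
  simp only [h]
  rw [Finset.sum_comm]
  refine Finset.sum_congr rfl fun l hl => ?_
  have h1 := hM l hl
  have h2 := ((mem_adm hL).1 hl).1.two_mul_numClose_le
  rw [Finset.sum_eq_single_of_mem (l.length - 2 * numClose l) (by simp; omega),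
    Finset.sum_eq_single_of_mem (numClose l) (by simp; omega)]
  · rw [typeWeight, if_pos (by omega)]
  · intro n _ hn
    rw [typeWeight, if_neg (by omega)]
  · intro m _ hm
    refine Finset.sum_eq_zero fun n _ => ?_
    rw [typeWeight, if_neg (by omega)]

theorem doubleSum_eq_sum_adm {r L : ℕ} (hL : 1 ≤ L) {T : ℤ → ℕ → ℕ → ℤ[X]} (hT : Bounded T)
    (h : ∀ N m n : ℕ, T N m n = typeSum r L N m n) (N : ℕ) :
    doubleSum T N = ∑ l ∈ adm r L N, (X ^ l.sum : ℤ[X]) := by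
  rw [doubleSum_eq hT (M := (adm r L N).sup List.length + N + 2) (by omega)]
  simp only [h]
  refine sum_typeSum hL fun l hl => ?_
  have := Finset.le_sup (f := List.length) hl
  omega

/-- The generating function of the lists in `adm 1 1 N` in which `2` occurs at most once. -/
noncomputable def sumFive (N : ℕ) : ℤ[X] :=
  ∑ l ∈ adm 1 1 N, if l.count 2 ≤ 1 then X ^ l.sum else 0

/-- For `N ≥ 5` the removed parts `N`, `N - 1`, `N - 2` are at least `3`, so the number of parts `2`
does not change and `sum_adm` respects the extra condition. -/
theorem sumFive_rec {N : ℕ} (hN : 5 ≤ N) : sumFive N = sumFive (N - 1) + X ^ N *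
    (if N % 3 = 1 then (1 + X ^ (N - 1)) * sumFive (N - 3) + X ^ (N - 2) * sumFive (N - 4)
     else if N % 3 = 2 then sumFive (N - 2) + X ^ N * sumFive (N - 3)
     else sumFive (N - 2)) := by
  have h := sum_adm (r := 1) le_rfl (by norm_num) (by omega : 1 + 2 ≤ N)
    (fun l => (if l.count 2 ≤ 1 then X ^ l.sum else 0 : ℤ[X]))
  rw [sumFive, h, ← sumFive]
  congr 1
  have e1 : ∀ (a : ℕ) (l : List ℕ), 3 ≤ a → (if (a :: l).count 2 ≤ 1 then X ^ (a :: l).sum else 0)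
      = X ^ a * (if l.count 2 ≤ 1 then X ^ l.sum else 0 : ℤ[X]) := by
    intro a l ha
    rw [List.count_cons_of_ne (by omega), List.sum_cons, pow_add, mul_ite, mul_zero]
  have e2 : ∀ (a : ℕ) (s : Finset (List ℕ)), 3 ≤ a →
      ∑ l ∈ s, (if (a :: l).count 2 ≤ 1 then X ^ (a :: l).sum else 0)
      = X ^ a * ∑ l ∈ s, (if l.count 2 ≤ 1 then X ^ l.sum else 0 : ℤ[X]) := by
    intro a s ha
    rw [Finset.mul_sum]
    exact Finset.sum_congr rfl fun l _ => e1 a l ha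
  have e3 : ∀ (a b : ℕ) (s : Finset (List ℕ)), 3 ≤ a → 3 ≤ b →
      ∑ l ∈ s, (if (a :: b :: l).count 2 ≤ 1 then X ^ (a :: b :: l).sum else 0)
      = X ^ a * (X ^ b * ∑ l ∈ s, (if l.count 2 ≤ 1 then X ^ l.sum else 0 : ℤ[X])) := by
    intro a b s ha hb
    rw [Finset.mul_sum, Finset.mul_sum]
    exact Finset.sum_congr rfl fun l _ => by rw [e1 a _ ha, e1 b _ hb]
  unfold topSum
  simp only [show (2 * 1 + 2) % 3 = 1 from rfl, show (2 * 1 + 2 + 1) % 3 = 2 from rfl]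
  split_ifs with c1 c2
  · rw [e2 _ _ (by omega), e3 _ _ _ (by omega) (by omega), e3 _ _ _ (by omega) (by omega)]
    unfold sumFive
    ring
  · rw [e2 _ _ (by omega), e3 _ _ _ (by omega) (by omega)]
    unfold sumFive
    ring
  · rw [e2 _ _ (by omega)]
    rfl

/-- The totals are compared and not the types: the factor `1 + X` in `term5` combines partitions
with different numbers of singletons. -/
theorem KR5_eq_sumFive (N : ℕ) (hN : 1 ≤ N) : KR5 N = sumFive N := by
  induction N using Nat.strong_induction_on with
  | _ N ih =>
    rcases Nat.lt_or_ge N 5 with h | h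
    · interval_cases N
      · rw [Nat.cast_one, KR5_one, sumFive, adm_1_1_1]
        simp
      · rw [Nat.cast_ofNat, KR5_two, sumFive, adm_1_1_2]
        simp
        ring
      · rw [Nat.cast_ofNat, KR5_three, sumFive, adm_1_1_3]
        simp
        ring
      · rw [Nat.cast_ofNat, KR5_four, sumFive, adm_1_1_4]
        simp
        ring
    · have h5 : Recurrence 1 KR5 N := (termRecurrence_term5 h).recurrence term5_eq_zero
      have e : ∀ j : ℕ, 1 ≤ j → j < N → ∀ i : ℤ, i = j → KR5 i = sumFive j := by
        rintro j h1 h2 i rfl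
        exact ih j h2 h1
      rw [h5, sumFive_rec h, e (N - 1) (by omega) (by omega) (N - 1) (by omega),
        e (N - 2) (by omega) (by omega) (N - 2) (by omega),
        e (N - 3) (by omega) (by omega) (N - 3) (by omega),
        e (N - 4) (by omega) (by omega) (N - 4) (by omega)]

/-! ### From lists to partitions -/

theorem Good.pairwise {r : ℕ} : ∀ {l : List ℕ}, Good r l → l.Pairwise (· ≥ ·)
  | [], _ => List.Pairwise.nil
  | _ :: _, h => List.pairwise_cons.2 ⟨fun x hx => h.le_head x hx, h.tail.pairwise⟩

theorem good_iff_getElem {r : ℕ} : ∀ {d : List ℕ}, d.Pairwise (· ≥ ·) → (Good r d ↔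
    (∀ (i : ℕ) (h : i + 2 < d.length), d[i + 2] + 3 ≤ d[i]) ∧
    (∀ (i : ℕ) (h : i + 1 < d.length), d[i] - d[i + 1] ≤ 1 → d[i + 1] + d[i] ≡ r [MOD 3]))
  | [], _ => by simp
  | [a], _ => by simp
  | a :: b :: l, hd => by
    rw [Good, good_iff_getElem (List.pairwise_cons.1 hd).2]
    have hab : b ≤ a := (List.pairwise_cons.1 hd).1 b (by simp)
    constructor
    · rintro ⟨-, h1, h2, h3, h4⟩
      refine ⟨fun i hi => ?_, fun i hi => ?_⟩
      · cases i with
        | zero =>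
          cases l with
          | nil => simp at hi
          | cons c l => exact h2 c rfl
        | succ i => exact h3 i (by simpa using hi)
      · cases i with
        | zero =>
          intro h
          have h' : a - b ≤ 1 := h
          have := h1 (by omega)
          change (b + a) % 3 = r % 3
          rwa [add_comm]
        | succ i => exact h4 i (by simpa using hi)
    · rintro ⟨h1, h2⟩
      refine ⟨hab, fun h => ?_, fun c hc => ?_, fun i hi => ?_, fun i hi => ?_⟩
      · have h' : (b + a) % 3 = r % 3 := h2 0 (by simp) (by simpa using (by omega : a - b ≤ 1))
        rwa [add_comm]
      · cases l with
        | nil => simp at hc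
        | cons d l =>
          obtain rfl : d = c := by simpa using hc
          exact h1 0 (by simp)
      · exact h1 (i + 1) (by simpa using hi)
      · exact h2 (i + 1) (by simpa using hi)

/-- The parts of a partition in non-increasing order. -/
def descParts {k : ℕ} (p : k.Partition) : List ℕ := (sortedParts p).reverse

theorem descParts_pairwise {k : ℕ} (p : k.Partition) : (descParts p).Pairwise (· ≥ ·) := by
  rw [descParts, List.pairwise_reverse]
  exact Multiset.pairwise_sort _ _

theorem coe_descParts {k : ℕ} (p : k.Partition) : (descParts p : Multiset ℕ) = p.parts := by
  rw [descParts, Multiset.coe_reverse, sortedParts, Multiset.sort_eq]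

theorem mem_descParts {k : ℕ} (p : k.Partition) (x : ℕ) : x ∈ descParts p ↔ x ∈ p.parts := by
  rw [← coe_descParts, Multiset.mem_coe]

theorem descParts_eq {k : ℕ} {p : k.Partition} {l : List ℕ} (hl : l.Pairwise (· ≥ ·))
    (h : (l : Multiset ℕ) = p.parts) : descParts p = l := by
  refine List.Perm.eq_of_pairwise (fun a b _ _ h1 h2 => le_antisymm h2 h1) (descParts_pairwise p) hl
    ?_
  rw [← Multiset.coe_eq_coe, coe_descParts, h]

theorem sum_descParts {k : ℕ} (p : k.Partition) : (descParts p).sum = k := by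
  rw [← Multiset.sum_coe, coe_descParts, p.parts_sum]

theorem getElem_reverse_iff {r : ℕ} (d : List ℕ) :
    ((∀ (i : ℕ) (h : i + 2 < d.reverse.length), d.reverse[i] + 3 ≤ d.reverse[i + 2]) ∧
      (∀ (i : ℕ) (h : i + 1 < d.reverse.length), d.reverse[i + 1] - d.reverse[i] ≤ 1 →
        d.reverse[i] + d.reverse[i + 1] ≡ r [MOD 3])) ↔
    (∀ (i : ℕ) (h : i + 2 < d.length), d[i + 2] + 3 ≤ d[i]) ∧
      (∀ (i : ℕ) (h : i + 1 < d.length), d[i] - d[i + 1] ≤ 1 → d[i + 1] + d[i] ≡ r [MOD 3]) := by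
  refine and_congr ⟨fun h i hi => ?_, fun h i hi => ?_⟩ ⟨fun h i hi => ?_, fun h i hi => ?_⟩
  · have := h (d.length - 3 - i) (by simp; omega)
    simp only [List.getElem_reverse] at this
    convert this using 3 <;> omega
  · rw [List.length_reverse] at hi
    have := h (d.length - 3 - i) (by omega)
    have e1 : d.length - 1 - i = d.length - 3 - i + 2 := by omega
    have e2 : d.length - 1 - (i + 2) = d.length - 3 - i := by omega
    simp only [List.getElem_reverse, e1, e2]
    exact this
  · have := h (d.length - 2 - i) (by simp; omega)
    simp only [List.getElem_reverse] at this
    convert this using 3 <;> first | omega | (congr 1; omega)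
  · rw [List.length_reverse] at hi
    have := h (d.length - 2 - i) (by omega)
    simp only [List.getElem_reverse]
    convert this using 3 <;> first | omega | (congr 1; omega)

theorem gapCond_iff {r k : ℕ} (p : k.Partition) : GapCond r p ↔ Good r (descParts p) := by
  rw [good_iff_getElem (descParts_pairwise p), GapCond]
  have e : sortedParts p = (descParts p).reverse := by rw [descParts, List.reverse_reverse]
  simp only [e]
  exact getElem_reverse_iff (descParts p)

/-- Putting `a` in front of `b :: l` appends it to the reversed list, so the only new index is
`l.length`, where `b` and `a` are neighbours. Finiteness is carried along because `Set.ncard` of an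
`insert` needs it. -/
theorem card_pairs_reverse : ∀ {d : List ℕ}, d.Pairwise (· ≥ ·) →
    {i : ℕ | ∃ h : i + 1 < d.reverse.length, d.reverse[i + 1] - d.reverse[i] ≤ 1}.Finite ∧
    {i : ℕ | ∃ h : i + 1 < d.reverse.length, d.reverse[i + 1] - d.reverse[i] ≤ 1}.ncard
      = numClose d
  | [], _ => by simp [numClose]
  | [a], _ => by simp [numClose]
  | a :: b :: l, hd => by
    have ih := card_pairs_reverse (List.pairwise_cons.1 hd).2
    have hab : b ≤ a := (List.pairwise_cons.1 hd).1 b (by simp)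
    have key : {i : ℕ | ∃ h : i + 1 < (a :: b :: l).reverse.length,
          (a :: b :: l).reverse[i + 1] - (a :: b :: l).reverse[i] ≤ 1}
        = if a ≤ b + 1 then insert l.length {i : ℕ | ∃ h : i + 1 < (b :: l).reverse.length,
            (b :: l).reverse[i + 1] - (b :: l).reverse[i] ≤ 1}
          else {i : ℕ | ∃ h : i + 1 < (b :: l).reverse.length,
            (b :: l).reverse[i + 1] - (b :: l).reverse[i] ≤ 1} := by
      ext i
      rcases lt_trichotomy i l.length with hi | rfl | hi
      · split_ifs <;>
          simp [List.getElem_append, hi, hi.ne] <;> exact fun _ => hi.le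
      · split_ifs <;> simp [List.getElem_append] <;> omega
      · split_ifs
        · constructor
          · rintro ⟨h, -⟩
            simp at h
            omega
          · rintro (h | ⟨h, -⟩)
            · omega
            · simp at h
              omega
        · constructor <;>
          · rintro ⟨h, -⟩
            simp at h
            omega
    have hnot : l.length ∉ {i : ℕ | ∃ h : i + 1 < (b :: l).reverse.length,
        (b :: l).reverse[i + 1] - (b :: l).reverse[i] ≤ 1} := by
      simp
    rw [key, numClose]
    split_ifs
    · exact ⟨ih.1.insert _, by rw [Set.ncard_insert_of_notMem hnot ih.1, ih.2, add_comm]⟩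
    · exact ⟨ih.1, by rw [ih.2, zero_add]⟩

theorem numPairs_eq {k : ℕ} (p : k.Partition) : numPairs p = numClose (descParts p) := by
  rw [← (card_pairs_reverse (descParts_pairwise p)).2, numPairs, ← Nat.card_coe_set_eq]
  have e : sortedParts p = (descParts p).reverse := by rw [descParts, List.reverse_reverse]
  simp only [e]
  rfl

theorem hasType_iff {k m n : ℕ} (p : k.Partition) :
    HasType m n p ↔ numClose (descParts p) = n ∧ (descParts p).length = m + 2 * n := by
  rw [HasType, numPairs_eq, ← coe_descParts, Multiset.coe_card]

theorem descParts_mem_adm {r L N : ℕ} (hL : 1 ≤ L) {k : ℕ} (p : k.Partition) :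
    descParts p ∈ adm r L N ↔ GapCond r p ∧ (∀ x ∈ p.parts, L ≤ x) ∧ PartsLE N p := by
  simp only [mem_adm hL, gapCond_iff, mem_descParts, PartsLE, forall_and]

/-- A sum over `adm r L N` is a generating function of partitions. -/
theorem isGenFun_sum {r L N : ℕ} (hL : 1 ≤ L) (C : List ℕ → Prop) [DecidablePred C] {f : ℤ[X]}
    (hf : f = ∑ l ∈ adm r L N, if C l then X ^ l.sum else 0)
    {P : ∀ {k : ℕ}, k.Partition → Prop}
    (hP : ∀ {k : ℕ} (p : k.Partition), P p ↔ descParts p ∈ adm r L N ∧ C (descParts p)) :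
    IsGenFun f P := by
  intro k
  have e : ∀ l : List ℕ, (if C l then X ^ l.sum else 0 : ℤ[X]).coeff k
      = if C l ∧ l.sum = k then 1 else 0 := by
    intro l
    by_cases h : C l
    · simp [h, coeff_X_pow, eq_comm]
    · simp [h]
  rw [Polynomial.coeff_coe, hf, finsetSum_coeff]
  simp only [e]
  rw [Finset.sum_boole]
  congr 1
  rw [← Nat.card_eq_finsetCard]
  symm
  refine Nat.card_congr (Equiv.ofBijective
    (fun p => ⟨descParts p.1, Finset.mem_filter.2 ⟨((hP p.1).1 p.2).1, ((hP p.1).1 p.2).2,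
      sum_descParts p.1⟩⟩) ⟨?_, ?_⟩)
  · rintro ⟨p, hp⟩ ⟨p', hp'⟩ h
    have h' : descParts p = descParts p' := congrArg Subtype.val h
    refine Subtype.ext (Nat.Partition.ext ?_)
    rw [← coe_descParts, h', coe_descParts]
  · rintro ⟨l, hl⟩
    obtain ⟨h1, h2, h3⟩ := Finset.mem_filter.1 hl
    have h4 := (mem_adm hL).1 h1
    -- The bound `1 ≤ L` makes the entries of the list positive, as the parts of a partition must
    -- be.
    let p : k.Partition := ⟨(l : Multiset ℕ), fun {i} hi => by
      have := (h4.2 i (by simpa using hi)).1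
      omega, by simpa using h3⟩
    have h5 : descParts p = l := descParts_eq h4.1.pairwise rfl
    refine ⟨⟨p, (hP p).2 ?_⟩, Subtype.ext h5⟩
    rw [h5]
    exact ⟨h1, h2⟩

theorem isGenFun_of_typeSum {r L N : ℕ} (hL : 1 ≤ L) (m n : ℕ) {P : ∀ {k : ℕ}, k.Partition → Prop}
    (hP : ∀ {k : ℕ} (p : k.Partition),
      P p ↔ (GapCond r p ∧ ∀ x ∈ p.parts, L ≤ x) ∧ PartsLE N p ∧ HasType m n p) :
    IsGenFun (typeSum r L N m n : ℤ[X]) P :=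
  isGenFun_sum hL (fun l => numClose l = n ∧ l.length = m + 2 * n) rfl fun p => by
    rw [hP, descParts_mem_adm hL, hasType_iff]
    tauto

theorem isGenFun_of_sum_adm {r L N : ℕ} (hL : 1 ≤ L) {P : ∀ {k : ℕ}, k.Partition → Prop}
    (hP : ∀ {k : ℕ} (p : k.Partition),
      P p ↔ (GapCond r p ∧ ∀ x ∈ p.parts, L ≤ x) ∧ PartsLE N p) :
    IsGenFun (∑ l ∈ adm r L N, (X ^ l.sum : ℤ[X]) : ℤ[X]) P :=
  isGenFun_sum (r := r) (N := N) hL (fun _ => True) (by simp) fun p => by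
    rw [hP, descParts_mem_adm hL]
    tauto

theorem isGenFun_KR1 (N : ℕ) : IsGenFun (KR1 N) (fun p => I1 p ∧ PartsLE N p) := by
  rw [KR1, doubleSum_eq_sum_adm le_rfl term1_eq_zero term1_eq_typeSum]
  exact isGenFun_of_sum_adm le_rfl fun p =>
    and_congr_left fun _ => ⟨fun h => ⟨h, fun x hx => p.parts_pos hx⟩, fun h => h.1⟩

theorem isGenFun_KR2 (N : ℕ) : IsGenFun (KR2 N) (fun p => I2 p ∧ PartsLE N p) := by
  rw [KR2, doubleSum_eq_sum_adm (by norm_num) term2_eq_zero term2_eq_typeSum]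
  exact isGenFun_of_sum_adm (by norm_num) fun p => Iff.rfl

theorem isGenFun_KR3 (N : ℕ) : IsGenFun (KR3 N) (fun p => I3 p ∧ PartsLE N p) := by
  rw [KR3, doubleSum_eq_sum_adm (by norm_num) term3_eq_zero term3_eq_typeSum]
  exact isGenFun_of_sum_adm (by norm_num) fun p => Iff.rfl

theorem isGenFun_KR4 (N : ℕ) : IsGenFun (KR4 N) (fun p => I4 p ∧ PartsLE N p) := by
  rw [KR4, doubleSum_eq_sum_adm (by norm_num) term4_eq_zero term4_eq_typeSum]
  exact isGenFun_of_sum_adm (by norm_num) fun p => Iff.rfl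

theorem isGenFun_KR5 (N : ℕ) (hN : 1 ≤ N) : IsGenFun (KR5 N) (fun p => I5 p ∧ PartsLE N p) := by
  refine isGenFun_sum le_rfl (fun l => l.count 2 ≤ 1) (KR5_eq_sumFive N hN) fun p => ?_
  rw [descParts_mem_adm le_rfl, I5, ← coe_descParts, Multiset.coe_count, coe_descParts]
  have h : ∀ x ∈ p.parts, 1 ≤ x := fun x hx => p.parts_pos hx
  tauto

theorem isGenFun_term4 (N m n : ℕ) :
    IsGenFun (term4 N m n) (fun p => I4 p ∧ PartsLE N p ∧ HasType m n p) := by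
  rw [term4_eq_typeSum]
  exact isGenFun_of_typeSum (by norm_num) m n fun p => Iff.rfl

/-! ### The limit -/

theorem map_gaussBinom {R S : Type*} [CommRing R] [CommRing S] (f : R →+* S) (q : R) :
    ∀ N n : ℕ, f (gaussBinom q N n) = gaussBinom (f q) N n
  | N, 0 => by simp [gaussBinom_zero]
  | 0, n + 1 => by simp [gaussBinom]
  | N + 1, n + 1 => by
    rw [gaussBinom_succ, gaussBinom_succ, map_add, map_mul, map_pow, map_gaussBinom f q N n,
      map_gaussBinom f q N (n + 1)]

theorem constantCoeff_qPoch {q : PowerSeries ℤ} (hq : PowerSeries.constantCoeff q = 0) (n : ℕ) :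
    PowerSeries.constantCoeff (qPoch q q n) = 1 := by
  simp [qPoch, map_prod, hq]

theorem qPoch_ne_zero {q : PowerSeries ℤ} (hq : PowerSeries.constantCoeff q = 0) (n : ℕ) :
    qPoch q q n ≠ 0 := fun h => by
  have := constantCoeff_qPoch hq n
  rw [h, map_zero] at this
  exact zero_ne_one this

theorem qPoch_mul_invOfUnit {q : PowerSeries ℤ} (hq : PowerSeries.constantCoeff q = 0) (n : ℕ) :
    qPoch q q n * PowerSeries.invOfUnit (qPoch q q n) 1 = 1 :=
  PowerSeries.mul_invOfUnit _ _ (by simp [constantCoeff_qPoch hq])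

/-- Cancelling `(q; q)_d` leaves a numerator with a fixed number `n` of factors, each of which tends
to `1` as `d → ∞`. -/
theorem gaussBinom_eq_prod_mul {q : PowerSeries ℤ} (hq : PowerSeries.constantCoeff q = 0)
    (n d : ℕ) : gaussBinom q (d + n) n
      = (∏ j ∈ Finset.range n, (1 - q * q ^ (d + j))) * PowerSeries.invOfUnit (qPoch q q n) 1 := by
  have h1 := gaussBinom_add_mul q n d
  have h2 : qPoch q q (n + d) = qPoch q q d * ∏ j ∈ Finset.range n, (1 - q * q ^ (d + j)) := by
    rw [add_comm, qPoch, Finset.prod_range_add]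
    rfl
  have h3 : gaussBinom q (d + n) n * qPoch q q n
      = ∏ j ∈ Finset.range n, (1 - q * q ^ (d + j)) := by
    refine mul_left_cancel₀ (qPoch_ne_zero hq d) ?_
    rw [← h2, ← h1, add_comm d n]
    ring
  rw [← h3, mul_assoc, qPoch_mul_invOfUnit hq, mul_one]

theorem tendsto_gaussBinom {q : PowerSeries ℤ} (hq : PowerSeries.constantCoeff q = 0) (n : ℕ) :
    Tendsto (fun a : ℕ => gaussBinom q a n) atTop
      (𝓝 (PowerSeries.invOfUnit (qPoch q q n) 1)) := by
  rw [← tendsto_add_atTop_iff_nat n]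
  simp only [gaussBinom_eq_prod_mul hq]
  have h0 : Tendsto (fun d : ℕ => q ^ d) atTop (𝓝 0) :=
    PowerSeries.WithPiTopology.isTopologicallyNilpotent_of_constantCoeff_zero hq
  have h1 : ∀ j ∈ Finset.range n, Tendsto (fun d : ℕ => 1 - q * q ^ (d + j)) atTop (𝓝 1) := by
    intro j _
    have h2 := (h0.comp (tendsto_add_atTop_nat j)).const_mul q
    simpa using h2.const_sub 1
  simpa using (tendsto_finsetProd _ h1).mul_const (PowerSeries.invOfUnit (qPoch q q n) 1)

theorem tendsto_qbin {q : ℤ[X]} (hq : PowerSeries.constantCoeff (q : PowerSeries ℤ) = 0) (n : ℕ)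
    {a : ℕ → ℤ} (ha : Tendsto a atTop atTop) :
    Tendsto (fun N : ℕ => ((qbin q (a N) n : ℤ[X]) : PowerSeries ℤ)) atTop
      (𝓝 (PowerSeries.invOfUnit (qPoch (q : PowerSeries ℤ) q n) 1)) := by
  have h1 : Tendsto (fun N => (a N).toNat) atTop atTop := by
    refine tendsto_atTop.2 fun b => ?_
    filter_upwards [tendsto_atTop.1 ha b] with N hN
    omega
  refine ((tendsto_gaussBinom hq n).comp h1).congr' ?_
  filter_upwards [tendsto_atTop.1 ha 0] with N hN
  rw [qbin, if_pos hN]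
  exact (map_gaussBinom Polynomial.coeToPowerSeries.ringHom q _ _).symm

theorem invDenom_eq (m n : ℕ) : invDenom m n
    = PowerSeries.invOfUnit (qPoch ((X : ℤ[X]) : PowerSeries ℤ) (X : ℤ[X]) m) 1
      * PowerSeries.invOfUnit
        (qPoch ((X ^ 3 : ℤ[X]) : PowerSeries ℤ) (X ^ 3 : ℤ[X]) n) 1 := by
  have h1 := denom_mul_invDenom m n
  have h2 := qPoch_mul_invOfUnit (q := PowerSeries.X) (by simp) m
  have h3 := qPoch_mul_invOfUnit (q := PowerSeries.X ^ 3) (by simp) n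
  rw [Polynomial.coe_X, Polynomial.coe_pow, Polynomial.coe_X]
  refine mul_left_cancel₀ (left_ne_zero_of_mul_eq_one h1) ?_
  rw [h1, denom, mul_mul_mul_comm, h2, h3, one_mul]

theorem tendsto_qbin_mul_qbin {a b : ℕ → ℤ} (ha : Tendsto a atTop atTop)
    (hb : Tendsto b atTop atTop) (m n : ℕ) :
    Tendsto (fun N : ℕ => ((qbin X (a N) m * qbin (X ^ 3) (b N) n : ℤ[X]) : PowerSeries ℤ)) atTop
      (𝓝 (invDenom m n)) := by
  rw [invDenom_eq]
  simp only [Polynomial.coe_mul]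
  exact (tendsto_qbin (by simp) m ha).mul (tendsto_qbin (by simp) n hb)

theorem tendsto_genTerm (α δ : ℕ) (m n : ℕ) :
    Tendsto (fun N : ℕ => ((genTerm α δ N m n : ℤ[X]) : PowerSeries ℤ)) atTop
      (𝓝 (PowerSeries.X ^ (m ^ 2 + 3 * m * n + 3 * n ^ 2 + α * m + 3 * δ * n) * invDenom m n)) := by
  have h := tendsto_qbin_mul_qbin (a := fun N : ℕ => (N : ℤ) - m - 3 * n + 1 - α)
    (b := fun N : ℕ => 2 * (N : ℤ) / 3 - m - n + 1 - δ)
    (tendsto_atTop.2 fun c => eventually_atTop.2 ⟨(c + m + 3 * n + α).toNat, fun N hN => by omega⟩)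
    (tendsto_atTop.2 fun c => eventually_atTop.2
      ⟨(2 * (c + m + n + δ)).toNat, fun N hN => by omega⟩) m n
  refine (h.const_mul (PowerSeries.X ^ (m ^ 2 + 3 * m * n + 3 * n ^ 2 + α * m + 3 * δ * n))).congr'
    (eventually_atTop.2 ⟨m + 3 * n + α, fun N hN => ?_⟩)
  beta_reduce
  rw [genTerm, qbinStar, if_neg (by omega)]
  simp only [Polynomial.coe_mul, Polynomial.coe_pow, Polynomial.coe_X]

theorem tendsto_liftTerm {T : ℤ → ℕ → ℕ → ℤ[X]} {m n : ℕ} {g : PowerSeries ℤ}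
    (h : Tendsto (fun N : ℕ => (T N m n : PowerSeries ℤ)) atTop (𝓝 g)) :
    Tendsto (fun N : ℕ => (liftTerm T N m n : PowerSeries ℤ)) atTop
      (𝓝 (PowerSeries.X ^ (m + 2 * n) * g)) := by
  have h1 : Tendsto (fun N : ℕ => N - 1) atTop atTop := tendsto_sub_atTop_nat 1
  refine ((h.comp h1).const_mul (PowerSeries.X ^ (m + 2 * n))).congr'
    (eventually_atTop.2 ⟨1, fun N hN => ?_⟩)
  beta_reduce
  rw [liftTerm, Polynomial.coe_mul, Polynomial.coe_pow, Polynomial.coe_X, Function.comp,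
    Nat.cast_sub hN, Nat.cast_one]

theorem tendsto_term1 (m n : ℕ) :
    Tendsto (fun N : ℕ => (term1 N m n : PowerSeries ℤ)) atTop (𝓝 (serTerm1 (m, n))) := by
  simpa [term1_eq_genTerm, serTerm1] using tendsto_genTerm 0 0 m n

theorem tendsto_term2 (m n : ℕ) :
    Tendsto (fun N : ℕ => (term2 N m n : PowerSeries ℤ)) atTop (𝓝 (serTerm2 (m, n))) := by
  simpa [term2_eq_genTerm, serTerm2] using tendsto_genTerm 1 1 m n

theorem tendsto_term3 (m n : ℕ) :
    Tendsto (fun N : ℕ => (term3 N m n : PowerSeries ℤ)) atTop (𝓝 (serTerm3 (m, n))) := by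
  simpa [term3_eq_genTerm, serTerm3] using tendsto_genTerm 2 1 m n

theorem tendsto_term4 (m n : ℕ) :
    Tendsto (fun N : ℕ => (term4 N m n : PowerSeries ℤ)) atTop (𝓝 (serTerm4 (m, n))) := by
  have h := tendsto_liftTerm (tendsto_term1 m n)
  simp only [← term4_eq] at h
  convert h using 2
  rw [serTerm1, serTerm4]
  ring

theorem tendsto_term5 (m n : ℕ) :
    Tendsto (fun N : ℕ => (term5 N m n : PowerSeries ℤ)) atTop (𝓝 (serTerm5 (m, n))) := by
  have h := ((tendsto_liftTerm (tendsto_term4 m n)).const_mul (1 + PowerSeries.X)).add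
    ((tendsto_liftTerm (tendsto_liftTerm (tendsto_term2 m n))).const_mul (PowerSeries.X ^ 2))
  convert h using 2 with N
  · rw [term5_eq]
    simp
  · rw [serTerm4, serTerm2, serTerm5]
    ring

/-- Termwise convergence, together with the summands being of large order, implies convergence of
the double sums. -/
theorem tendsToSeries_of_term {T : ℤ → ℕ → ℕ → ℤ[X]} {t : ℕ × ℕ → PowerSeries ℤ}
    (hT : ∀ m n, Tendsto (fun N : ℕ => (T N m n : PowerSeries ℤ)) atTop (𝓝 (t (m, n))))
    (hX : ∀ (N : ℕ) (m n k : ℕ), k < m ∨ k < n → (T N m n).coeff k = 0) :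
    TendsToSeries (doubleSum T) t := by
  have hTc : ∀ m n k, Tendsto (fun N : ℕ => (T N m n).coeff k) atTop
      (𝓝 (PowerSeries.coeff k (t (m, n)))) := fun m n k => by
    have := ((PowerSeries.WithPiTopology.continuous_coeff ℤ k).tendsto _).comp (hT m n)
    simpa [Function.comp_def] using this
  have hX' : ∀ m n k, k < m ∨ k < n → PowerSeries.coeff k (t (m, n)) = 0 := fun m n k h => by
    refine tendsto_nhds_unique (hTc m n k) ?_
    simp only [hX _ m n k h]
    exact tendsto_const_nhds
  -- The coefficient of degree `k` only receives contributions from `m, n ≤ k`, so the sum is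
  -- explicit and finite in each degree.
  have hs : HasSum t (PowerSeries.mk fun k =>
      ∑ p ∈ Finset.range (k + 1) ×ˢ Finset.range (k + 1), PowerSeries.coeff k (t p)) := by
    rw [PowerSeries.WithPiTopology.hasSum_iff_hasSum_coeff]
    intro k
    rw [PowerSeries.coeff_mk]
    refine hasSum_sum_of_ne_finset_zero fun p hp => hX' p.1 p.2 k ?_
    simp only [Finset.mem_product, Finset.mem_range] at hp
    omega
  refine ⟨hs.summable, ?_⟩
  rw [hs.tsum_eq, PowerSeries.WithPiTopology.tendsto_iff_coeff_tendsto]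
  intro k
  rw [PowerSeries.coeff_mk]
  refine (tendsto_finsetSum _ fun p _ => hTc p.1 p.2 k).congr' ?_
  -- For `N ≥ k` the range of `doubleSum` contains the square `m, n ≤ k`.
  refine eventually_atTop.2 ⟨k, fun N hN => ?_⟩
  beta_reduce
  rw [Polynomial.coeff_coe, doubleSum, ← Finset.sum_product', finsetSum_coeff]
  refine Finset.sum_subset (Finset.product_subset_product (Finset.range_mono (by omega))
    (Finset.range_mono (by omega))) fun p _ hp => hX N p.1 p.2 k ?_
  simp only [Finset.mem_product, Finset.mem_range] at hp
  omega

theorem coeff_eq_zero_of_dvd {f : ℤ[X]} {e k : ℕ} (h : X ^ e ∣ f) (hk : k < e) : f.coeff k = 0 :=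
  X_pow_dvd_iff.1 h k hk

theorem coeff_genTerm {α δ : ℕ} {N : ℤ} {m n k : ℕ} (h : k < m ∨ k < n) :
    (genTerm α δ N m n).coeff k = 0 := by
  refine coeff_eq_zero_of_dvd (Dvd.intro _ rfl) ?_
  have h1 := Nat.le_self_pow two_ne_zero m
  have h2 := Nat.le_self_pow two_ne_zero n
  rcases h with h | h <;> nlinarith [Nat.zero_le (m * n), Nat.zero_le (α * m), Nat.zero_le (δ * n)]

theorem coeff_liftTerm {T : ℤ → ℕ → ℕ → ℤ[X]} {m n : ℕ}
    (hT : ∀ (N : ℤ) (k : ℕ), k < m ∨ k < n → (T N m n).coeff k = 0) (N : ℤ) (k : ℕ)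
    (h : k < m ∨ k < n) : (liftTerm T N m n).coeff k = 0 := by
  rw [liftTerm, coeff_X_pow_mul']
  split_ifs
  · exact hT _ _ (by omega)
  · rfl

theorem coeff_term4 {m n : ℕ} (N : ℤ) (k : ℕ) (h : k < m ∨ k < n) :
    (term4 N m n).coeff k = 0 := by
  rw [term4_eq]
  exact coeff_liftTerm (fun N k h => by rw [term1_eq_genTerm]; exact coeff_genTerm h) N k h

theorem coeff_term5 {m n : ℕ} (N : ℤ) (k : ℕ) (h : k < m ∨ k < n) :
    (term5 N m n).coeff k = 0 := by
  have h2 := coeff_liftTerm (coeff_liftTerm (T := term2) (m := m) (n := n) fun N k h => by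
    rw [term2_eq_genTerm]; exact coeff_genTerm h)
  have h4 := coeff_liftTerm (coeff_term4 (m := m) (n := n))
  rw [term5_eq, coeff_add, coeff_X_pow_mul', add_mul, one_mul, coeff_add, h4 N k h]
  have e : (X * liftTerm term4 N m n).coeff k = 0 := by
    cases k with
    | zero => simp
    | succ k =>
      rw [coeff_X_mul]
      exact h4 N k (by omega)
  rw [e]
  split_ifs
  · rw [h2 N _ (by omega)]; rfl
  · rfl

theorem tendsToSeries_KR1 : TendsToSeries KR1 serTerm1 :=
  tendsToSeries_of_term tendsto_term1 fun N m n k h => by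
    rw [term1_eq_genTerm]; exact coeff_genTerm h

theorem tendsToSeries_KR2 : TendsToSeries KR2 serTerm2 :=
  tendsToSeries_of_term tendsto_term2 fun N m n k h => by
    rw [term2_eq_genTerm]; exact coeff_genTerm h

theorem tendsToSeries_KR3 : TendsToSeries KR3 serTerm3 :=
  tendsToSeries_of_term tendsto_term3 fun N m n k h => by
    rw [term3_eq_genTerm]; exact coeff_genTerm h

theorem tendsToSeries_KR4 : TendsToSeries KR4 serTerm4 :=
  tendsToSeries_of_term tendsto_term4 fun N _ _ k h => coeff_term4 N k h

theorem tendsToSeries_KR5 : TendsToSeries KR5 serTerm5 :=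
  tendsToSeries_of_term tendsto_term5 fun N _ _ k h => coeff_term5 N k h

theorem partsLE_of_le {k N : ℕ} (h : k ≤ N) (p : k.Partition) : PartsLE N p := fun x hx => by
  have := Multiset.le_sum_of_mem hx
  rw [p.parts_sum] at this
  omega

/-- The limit of the generating functions of partitions into parts `≤ N` is the generating function
without the bound on the parts. -/
theorem isGenFun_of_tendsto {f : ℕ → PowerSeries ℤ} {g : PowerSeries ℤ}
    (h : Tendsto f atTop (𝓝 g)) {P : ∀ {k : ℕ}, k.Partition → Prop}
    {Q : ℕ → ∀ {k : ℕ}, k.Partition → Prop} (M : ℕ) (hf : ∀ N, M ≤ N → IsGenFun (f N) (Q N))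
    (hQ : ∀ (N : ℕ) {k : ℕ} (p : k.Partition), PartsLE N p → (Q N p ↔ P p)) : IsGenFun g P := by
  intro k
  have h1 := ((PowerSeries.WithPiTopology.continuous_coeff ℤ k).tendsto _).comp h
  -- Since `ℤ` is discrete, the coefficient is eventually constant; some `N ≥ k` reaches the limit
  -- value, and for it the bound on the parts of a partition of `k` is vacuous.
  rw [nhds_discrete, tendsto_pure] at h1
  obtain ⟨N, hN, hN1, hN2⟩ :=
    (h1.and ((eventually_ge_atTop M).and (eventually_ge_atTop k))).exists
  rw [← hN, Function.comp, hf N hN1 k]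
  congr 1
  exact Nat.card_congr (Equiv.subtypeEquivRight fun p => hQ N p (partsLE_of_le hN2 p))

theorem TendsToSeries.isGenFun {S : ℤ → ℤ[X]} {t : ℕ × ℕ → PowerSeries ℤ} (h : TendsToSeries S t)
    {P : ∀ {k : ℕ}, k.Partition → Prop}
    (hS : ∀ N : ℕ, 1 ≤ N → IsGenFun (S N) (fun p => P p ∧ PartsLE N p)) :
    IsGenFun (∑' p, t p) P :=
  isGenFun_of_tendsto h.2 (Q := fun N {_} p => P p ∧ PartsLE N p) 1 hS
    fun _ _ _ hp => and_iff_left hp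

theorem isGenFun_serTerm4 (m n : ℕ) :
    IsGenFun (serTerm4 (m, n)) (fun p => I4 p ∧ HasType m n p) :=
  isGenFun_of_tendsto (tendsto_term4 m n) (Q := fun N {_} p => I4 p ∧ PartsLE N p ∧ HasType m n p) 0
    (fun N _ => isGenFun_term4 N m n) fun _ _ _ hp => by simp only [hp, true_and]

end KanadeRussell

theorem mainTheorem6 :
    -- the finite double sums are the generating functions of partitions into parts `≤ N`
    (∀ N : ℕ, KanadeRussell.IsGenFun (KanadeRussell.KR1 N)
      (fun p => KanadeRussell.I1 p ∧ KanadeRussell.PartsLE N p)) ∧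
    (∀ N : ℕ, KanadeRussell.IsGenFun (KanadeRussell.KR2 N)
      (fun p => KanadeRussell.I2 p ∧ KanadeRussell.PartsLE N p)) ∧
    (∀ N : ℕ, KanadeRussell.IsGenFun (KanadeRussell.KR3 N)
      (fun p => KanadeRussell.I3 p ∧ KanadeRussell.PartsLE N p)) ∧
    (∀ N : ℕ, KanadeRussell.IsGenFun (KanadeRussell.KR4 N)
      (fun p => KanadeRussell.I4 p ∧ KanadeRussell.PartsLE N p)) ∧
    (∀ N : ℕ, 1 ≤ N → KanadeRussell.IsGenFun (KanadeRussell.KR5 N)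
      (fun p => KanadeRussell.I5 p ∧ KanadeRussell.PartsLE N p)) ∧
    -- they satisfy the recurrences, with initial conditions
    ((∀ N : ℕ, 1 ≤ N → KanadeRussell.Recurrence 2 KanadeRussell.KR1 N) ∧
      KanadeRussell.KR1 0 = 1 ∧ KanadeRussell.KR1 (-1) = 1 ∧
      ∀ N : ℤ, N < -1 → KanadeRussell.KR1 N = 0) ∧
    ((∀ N : ℕ, 3 ≤ N → KanadeRussell.Recurrence 2 KanadeRussell.KR2 N) ∧
      KanadeRussell.KR2 0 = 1 ∧ KanadeRussell.KR2 1 = 1 ∧ KanadeRussell.KR2 2 = 1 + X ^ 2) ∧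
    ((∀ N : ℕ, 1 ≤ N → KanadeRussell.Recurrence 2 KanadeRussell.KR3 N) ∧
      KanadeRussell.KR3 0 = 1 ∧ ∀ N : ℤ, N < 0 → KanadeRussell.KR3 N = 0) ∧
    ((∀ N : ℕ, 1 ≤ N → KanadeRussell.Recurrence 0 KanadeRussell.KR4 N) ∧
      KanadeRussell.KR4 0 = 1 ∧ ∀ N : ℤ, N < 0 → KanadeRussell.KR4 N = 0) ∧
    ((∀ N : ℕ, 5 ≤ N → KanadeRussell.Recurrence 1 KanadeRussell.KR5 N) ∧
      KanadeRussell.KR5 1 = 1 + X ∧ KanadeRussell.KR5 2 = 1 + X + X ^ 2 ∧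
      KanadeRussell.KR5 3 = 1 + X + X ^ 2 + X ^ 3 + X ^ 4 ∧
      KanadeRussell.KR5 4 =
        1 + X + X ^ 2 + X ^ 3 + 2 * X ^ 4 + X ^ 5 + X ^ 6 + X ^ 7 + X ^ 8) ∧
    -- they tend to the double series, the generating functions without the bound on the parts
    KanadeRussell.TendsToSeries KanadeRussell.KR1 KanadeRussell.serTerm1 ∧
    KanadeRussell.TendsToSeries KanadeRussell.KR2 KanadeRussell.serTerm2 ∧
    KanadeRussell.TendsToSeries KanadeRussell.KR3 KanadeRussell.serTerm3 ∧
    KanadeRussell.TendsToSeries KanadeRussell.KR4 KanadeRussell.serTerm4 ∧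
    KanadeRussell.TendsToSeries KanadeRussell.KR5 KanadeRussell.serTerm5 ∧
    KanadeRussell.IsGenFun (∑' p, KanadeRussell.serTerm1 p) KanadeRussell.I1 ∧
    KanadeRussell.IsGenFun (∑' p, KanadeRussell.serTerm2 p) KanadeRussell.I2 ∧
    KanadeRussell.IsGenFun (∑' p, KanadeRussell.serTerm3 p) KanadeRussell.I3 ∧
    KanadeRussell.IsGenFun (∑' p, KanadeRussell.serTerm4 p) KanadeRussell.I4 ∧
    KanadeRussell.IsGenFun (∑' p, KanadeRussell.serTerm5 p) KanadeRussell.I5 ∧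
    -- the pairs and singletons refinement of the fourth case
    (∀ N m n : ℕ, KanadeRussell.IsGenFun (KanadeRussell.term4 N m n)
      (fun p => KanadeRussell.I4 p ∧ KanadeRussell.PartsLE N p ∧ KanadeRussell.HasType m n p)) ∧
    (∀ m n : ℕ, KanadeRussell.IsGenFun (KanadeRussell.serTerm4 (m, n))
      (fun p => KanadeRussell.I4 p ∧ KanadeRussell.HasType m n p)) :=
  open KanadeRussell in
  ⟨isGenFun_KR1, isGenFun_KR2, isGenFun_KR3, isGenFun_KR4, isGenFun_KR5,
    ⟨fun N _ => (termRecurrence_term1 N).recurrence term1_eq_zero, KR1_zero, KR1_neg_one,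
      KR1_eq_zero⟩,
    ⟨fun _ hN => (termRecurrence_term2 hN).recurrence term2_eq_zero, KR2_zero, KR2_one, KR2_two⟩,
    ⟨fun _ hN => (termRecurrence_term3 hN).recurrence term3_eq_zero, KR3_zero, KR3_eq_zero⟩,
    ⟨fun _ hN => (termRecurrence_term4 hN).recurrence term4_eq_zero, KR4_zero, KR4_eq_zero⟩,
    ⟨fun _ hN => (termRecurrence_term5 hN).recurrence term5_eq_zero, KR5_one, KR5_two, KR5_three,
      KR5_four⟩,
    tendsToSeries_KR1, tendsToSeries_KR2, tendsToSeries_KR3, tendsToSeries_KR4, tendsToSeries_KR5,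
    tendsToSeries_KR1.isGenFun fun N _ => isGenFun_KR1 N,
    tendsToSeries_KR2.isGenFun fun N _ => isGenFun_KR2 N,
    tendsToSeries_KR3.isGenFun fun N _ => isGenFun_KR3 N,
    tendsToSeries_KR4.isGenFun fun N _ => isGenFun_KR4 N,
    tendsToSeries_KR5.isGenFun isGenFun_KR5,
    isGenFun_term4, isGenFun_serTerm4⟩
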